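/- Let $d\in\mathbb{N}^+$, $B_0>0$ and $\beta=s+r>0$ with $s\in\mathbb{N}_0$ and $r\in(0,1]$; write $\lfloor\beta\rfloor:=s$, so that $\lfloor\beta\rfloor$ is the largest integer strictly smaller than $\beta$. Let $\mathcal{H}^\beta([0,1]^d,B_0)$ be the set of functions $f:[0,1]^d\to\mathbb{R}$ whose partial derivatives $\partial^\alpha f$, $\alpha\in\mathbb{N}_0^d$, $\|\alpha\|_1\le s$, exist on $[0,1]^d$ (one-sided on the boundary) and satisfy $$\max_{\|\alpha\|_1\le s}\|\partial^\alpha f\|_\infty\le B_0,\qquad \max_{\|\alpha\|_1=s}\ \sup_{x\ne y}\frac{|\partial^\alpha f(x)-\partial^\alpha f(y)|}{\|x-y\|_2^{r}}\le B_0 .$$ A ReLU network of depth $\mathcal{D}$ and width $\mathcal{W}$ is a function $\mathcal{L}_{\mathcal{D}}\circ\sigma\circ\mathcal{L}_{\mathcal{D}-1}\circ\cdots\circ\sigma\circ\mathcal{L}_0:\mathbb{R}^d\to\mathbb{R}$ with affine maps $\mathcal{L}_i:\mathbb{R}^{p_i}\to\mathbb{R}^{p_{i+1}}$, $p_0=d$,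 $p_{\mathcal{D}+1}=1$, the coordinatewise activation $\sigma(t)=\max(0,t)$, and $\mathcal{W}=\max\{p_1,\dots,p_{\mathcal{D}}\}$. For $K\in\mathbb{N}^+$ and $\delta>0$ put $$\Omega([0,1]^d,K,\delta)=\bigcup_{i=1}^d\Big\{x=(x_1,\dots,x_d):\ x_i\in\bigcup_{k=1}^{K-1}\big(k/K-\delta,\ k/K\big)\Big\}.$$ Let $f\in\mathcal{H}^\beta([0,1]^d,B_0)$ and $N,M\in\mathbb{N}^+$, put $K=\lceil (MN)^{2/d}\rceil$, and let $\delta\in(0,1/(3K)]$ be arbitrary. Then there is a function $\phi_0$ implemented by a ReLU network of width $\mathcal{W}=38(\lfloor\beta\rfloor+1)^2d^{\lfloor\beta\rfloor+1}N\lceil\log_2(8N)\rceil$ and depth $\mathcal{D}=21(\lfloor\beta\rfloor+1)^2M\lceil\log_2(8M)\rceil$ such that $$|f(x)-\phi_0(x)|\le 18B_0(\lfloor\beta\rfloor+1)^2d^{\lfloor\beta\rfloor+\max\{\beta,1\}/2}(NM)^{-2\beta/d}\qquad\text{for all }x\in[0,1]^d\setminus\Omega([0,1]^d,K,\delta).$$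 -/

import Mathlib

/-- Fully connected feedforward ReLU networks from `ℝ^m` to `ℝ^n`: either a single affine map,
or a hidden layer (an affine map followed by the coordinatewise ReLU) followed by a network. -/
inductive ReLUNet : ℕ → ℕ → Type
  | affine {m n : ℕ} (W : Matrix (Fin n) (Fin m) ℝ) (b : Fin n → ℝ) : ReLUNet m n
  | layer {m k n : ℕ} (W : Matrix (Fin k) (Fin m) ℝ) (b : Fin k → ℝ) (rest : ReLUNet k n) :
      ReLUNet m n

namespace ReLUNet

/-- The function `ℝ^m → ℝ^n` implemented by the network. -/
noncomputable def eval : {m n : ℕ} → ReLUNet m n → (Fin m → ℝ) → (Fin n → ℝ)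
  | _, _, affine W b, x => W.mulVec x + b
  | _, _, layer W b rest, x => rest.eval (fun i => max 0 ((W.mulVec x + b) i))

/-- The depth: the number of hidden layers. -/
def depth : {m n : ℕ} → ReLUNet m n → ℕ
  | _, _, affine _ _ => 0
  | _, _, layer _ _ rest => rest.depth + 1

/-- The width: the maximal number of neurons in a hidden layer. -/
def width : {m n : ℕ} → ReLUNet m n → ℕ
  | _, _, affine _ _ => 0
  | _, _, layer (k := k) _ _ rest => max k rest.width

end ReLUNet

/-- The closed unit cube `[0,1]^d`. -/
def unitCube (d : ℕ) : Set (EuclideanSpace ℝ (Fin d)) :=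
  {x | ∀ i, x i ∈ Set.Icc (0 : ℝ) 1}

/-- The Hölder class `H^β([0,1]^d, B₀)` with `β = s + r`, `s ∈ ℕ`, `r ∈ (0,1]`. Only the values of
`f` on the cube matter. `D α` is the partial derivative `∂^α f` on the cube, for `|α| ≤ s` (one-sided
on the faces): `∂^0 f = f`, and `∂^(α + e_i) f` is the partial derivative of `∂^α f` in the `i`-th
coordinate. These requirements determine `D α` on the cube uniquely. -/
def HolderClass (d s : ℕ) (r B₀ : ℝ) (f : EuclideanSpace ℝ (Fin d) → ℝ) : Prop :=
  ∃ D : (Fin d → ℕ) → EuclideanSpace ℝ (Fin d) → ℝ,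
    (∀ x ∈ unitCube d, D 0 x = f x) ∧
    (∀ α : Fin d → ℕ, ∑ j, α j < s → ∀ i : Fin d, ∀ x ∈ unitCube d,
      HasLineDerivWithinAt ℝ (D α) (D (α + Pi.single i 1) x) (unitCube d) x
        (EuclideanSpace.single i (1 : ℝ))) ∧
    (∀ α : Fin d → ℕ, ∑ j, α j ≤ s → ∀ x ∈ unitCube d, |D α x| ≤ B₀) ∧
    (∀ α : Fin d → ℕ, ∑ j, α j = s → ∀ x ∈ unitCube d, ∀ y ∈ unitCube d,
      |D α x - D α y| ≤ B₀ * ‖x - y‖ ^ r)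

/-- The trifling region `Ω([0,1]^d, K, δ)`: some coordinate lies in an interval
`(k/K - δ, k/K)` with `1 ≤ k ≤ K - 1`. -/
def triflingRegion (d K : ℕ) (δ : ℝ) : Set (EuclideanSpace ℝ (Fin d)) :=
  {x | ∃ i : Fin d, ∃ k : ℕ, 1 ≤ k ∧ k < K ∧ x i ∈ Set.Ioo ((k : ℝ) / K - δ) ((k : ℝ) / K)}

/-! The network evaluates a Taylor polynomial of `f` of degree `s` at the centre of the cell
containing `x`. Cells have side `2 / K`, so every point is within `1 / K` of its centre in each
coordinate, and there are `(K + 1) / 2` cells per axis, hence at most `(N * M) ^ 2` in all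
(`card_cells_le`). With this radius the Taylor remainder (`HolderClass.abs_sub_taylor_le`) is of
order `K ^ (-β)`, at most `(N * M) ^ (-2 * β / d)`.

Three tasks remain for ReLU layers of width of order `N`. The cell index is a step function of `x`;
outside the trifling region it is computed exactly by steep ramps that strip digits
(`Computes.cells`). A Taylor coefficient depends only on the cell, so it is an entry of a table of
`(N * M) ^ 2` numbers. `Computes.lookup` reads it by bit extraction: two base-`N` digits of the
index and one of `M` layers select an integer that packs `M` entries, and the entry is then isolated
by peeling digits off that integer. Products of the increments `x i - y i` come from the
self-similarity of `x - x ^ 2` under zigzag maps (`zigzag_spec`, `Computes.monomial`).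

A digit system mixing base `N` with base `2` reaches `(N * M) ^ k` values in `k * (1 + Nat.clog 2
M)` layers of width of order `N`; it serves the digits, the precision of the table and the zigzags
alike. The coefficients and products are accurate to order `(N * M) ^ (-2 * (s + 1))`, which is
negligible because `β ≤ s + 1`. The terms of the polynomial run in parallel, one for each word of
length at most `s` in the coordinates. -/

namespace ReLUNet

/-! ### Networks, affine maps and single hidden layers. -/

/-- Append to a network a ReLU activation of its outputs followed by an affine map. -/
def snoc : {m n k : ℕ} → ReLUNet m n → Matrix (Fin k) (Fin n) ℝ → (Fin k → ℝ) → ReLUNet m k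
  | _, _, _, affine W₀ b₀, W, b => layer W₀ b₀ (affine W b)
  | _, _, _, layer W₀ b₀ rest, W, b => layer W₀ b₀ (rest.snoc W b)

theorem eval_snoc {m n k : ℕ} (φ : ReLUNet m n) (W : Matrix (Fin k) (Fin n) ℝ) (b : Fin k → ℝ)
    (x : Fin m → ℝ) :
    (φ.snoc W b).eval x = W.mulVec (fun i => max 0 (φ.eval x i)) + b := by
  induction φ with
  | affine W₀ b₀ => simp [snoc, eval]
  | layer W₀ b₀ rest ih => simp only [snoc, eval]; exact ih _ _

theorem depth_snoc {m n k : ℕ} (φ : ReLUNet m n) (W : Matrix (Fin k) (Fin n) ℝ) (b : Fin k → ℝ) :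
    (φ.snoc W b).depth = φ.depth + 1 := by
  induction φ with
  | affine W₀ b₀ => simp [snoc, depth]
  | layer W₀ b₀ rest ih => simp only [snoc, depth]; rw [ih]

theorem width_snoc {m n k : ℕ} (φ : ReLUNet m n) (W : Matrix (Fin k) (Fin n) ℝ) (b : Fin k → ℝ) :
    (φ.snoc W b).width = max φ.width n := by
  induction φ with
  | affine W₀ b₀ => simp [snoc, width]
  | layer W₀ b₀ rest ih => simp only [snoc, width]; rw [ih, max_assoc]

end ReLUNet

/-- Real-valued affine functions of finitely many real variables. -/
def IsAffine {ι : Type} [Fintype ι] (f : (ι → ℝ) → ℝ) : Prop :=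
  ∃ (c : ι → ℝ) (b : ℝ), ∀ v, f v = ∑ i, c i * v i + b

namespace IsAffine

variable {ι : Type} [Fintype ι] {f g : (ι → ℝ) → ℝ}

theorem const (a : ℝ) : IsAffine (fun _ : ι → ℝ => a) := ⟨0, a, by simp⟩

theorem coord (i : ι) : IsAffine (fun v : ι → ℝ => v i) := by
  classical
  exact ⟨Pi.single i 1, 0, fun v => by simp [Pi.single_apply]⟩

theorem add (hf : IsAffine f) (hg : IsAffine g) : IsAffine (fun v => f v + g v) := by
  obtain ⟨c, b, h⟩ := hf
  obtain ⟨c', b', h'⟩ := hg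
  refine ⟨c + c', b + b', fun v => ?_⟩
  simp only [h, h', Pi.add_apply, add_mul, Finset.sum_add_distrib]
  ring

theorem const_mul (a : ℝ) (hf : IsAffine f) : IsAffine (fun v => a * f v) := by
  obtain ⟨c, b, h⟩ := hf
  refine ⟨fun i => a * c i, a * b, fun v => ?_⟩
  simp only [h, mul_add, Finset.mul_sum, mul_assoc]

theorem mul_const (a : ℝ) (hf : IsAffine f) : IsAffine (fun v => f v * a) := by
  simpa only [mul_comm] using hf.const_mul a

theorem div_const (a : ℝ) (hf : IsAffine f) : IsAffine (fun v => f v / a) := by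
  simpa only [div_eq_mul_inv] using hf.mul_const a⁻¹

theorem neg (hf : IsAffine f) : IsAffine (fun v => -f v) := by
  simpa only [neg_one_mul] using hf.const_mul (-1)

theorem sub (hf : IsAffine f) (hg : IsAffine g) : IsAffine (fun v => f v - g v) := by
  simpa only [sub_eq_add_neg] using hf.add hg.neg

theorem sum {τ : Type*} (s : Finset τ) {F : τ → (ι → ℝ) → ℝ} (h : ∀ t ∈ s, IsAffine (F t)) :
    IsAffine (fun v => ∑ t ∈ s, F t v) := by
  classical
  induction s using Finset.induction_on with
  | empty => simpa using const 0
  | insert a s ha ih =>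
    simp only [Finset.sum_insert ha]
    exact (h a (Finset.mem_insert_self _ _)).add
      (ih fun t ht => h t (Finset.mem_insert_of_mem ht))

theorem comp {κ : Type} [Fintype κ] {g : (κ → ℝ) → ℝ} (hg : IsAffine g)
    {F : κ → (ι → ℝ) → ℝ} (hF : ∀ k, IsAffine (F k)) : IsAffine (fun v => g (fun k => F k v)) := by
  obtain ⟨c, b, h⟩ := hg
  simp only [h]
  exact (sum _ fun k _ => (hF k).const_mul _).add (const b)

end IsAffine

/-- Functions computed by one hidden layer of `n` ReLU neurons. -/
def IsShallow {ι : Type} [Fintype ι] (n : ℕ) (f : (ι → ℝ) → ℝ) : Prop :=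
  ∃ (a : Fin n → (ι → ℝ) → ℝ) (g : (Fin n → ℝ) → ℝ), (∀ j, IsAffine (a j)) ∧ IsAffine g ∧
    ∀ v, f v = g (fun j => max 0 (a j v))

namespace IsShallow

variable {ι : Type} [Fintype ι] {f g : (ι → ℝ) → ℝ} {n n' : ℕ}

theorem const (a : ℝ) : IsShallow 0 (fun _ : ι → ℝ => a) :=
  ⟨fun _ _ => 0, fun _ => a, fun _ => .const 0, .const a, fun _ => rfl⟩

theorem relu (hf : IsAffine f) : IsShallow 1 (fun v => max 0 (f v)) :=
  ⟨fun _ => f, fun u => u 0, fun _ => hf, .coord 0, fun _ => rfl⟩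

theorem add (hf : IsShallow n f) (hg : IsShallow n' g) :
    IsShallow (n + n') (fun v => f v + g v) := by
  obtain ⟨a, A, ha, hA, h⟩ := hf
  obtain ⟨b, B, hb, hB, h'⟩ := hg
  refine ⟨Fin.append a b, fun u => A (fun j => u (Fin.castAdd n' j)) +
    B (fun j => u (Fin.natAdd n j)), fun j => ?_,
    (hA.comp fun j => .coord _).add (hB.comp fun j => .coord _), fun v => ?_⟩
  · refine Fin.addCases (fun i => ?_) (fun i => ?_) j
    · simpa using ha i
    · simpa using hb i
  · simp [h, h']

theorem const_mul (a : ℝ) (hf : IsShallow n f) : IsShallow n (fun v => a * f v) := by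
  obtain ⟨b, B, hb, hB, h⟩ := hf
  exact ⟨b, fun u => a * B u, hb, hB.const_mul a, fun v => by simp only [h]⟩

theorem neg (hf : IsShallow n f) : IsShallow n (fun v => -f v) := by
  simpa only [neg_one_mul] using hf.const_mul (-1)

theorem sub (hf : IsShallow n f) (hg : IsShallow n' g) :
    IsShallow (n + n') (fun v => f v - g v) := by
  simpa only [sub_eq_add_neg] using hf.add hg.neg

/-- Since `t = max 0 t - max 0 (-t)`, transporting a value through a layer costs two neurons. This
is the source of the terms `Fintype.card κ * 2` in the width conditions. -/
theorem of_affine (hf : IsAffine f) : IsShallow 2 f := by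
  have h := (relu hf).sub (relu hf.neg)
  have e : (fun v => max 0 (f v) - max 0 (-f v)) = f := by
    funext v
    rcases le_total 0 (f v) with h | h
    · rw [max_eq_right h, max_eq_left (by linarith)]; ring
    · rw [max_eq_left h, max_eq_right (by linarith)]; ring
  rwa [e] at h

theorem coord (i : ι) : IsShallow 2 (fun v : ι → ℝ => v i) := of_affine (.coord i)

theorem mono (hf : IsShallow n f) (h : n ≤ n') : IsShallow n' f := by
  obtain ⟨k, rfl⟩ := Nat.exists_eq_add_of_le h
  obtain ⟨a, A, ha, hA, h⟩ := hf
  refine ⟨Fin.append a fun _ _ => 0, fun u => A (fun j => u (Fin.castAdd k j)), fun j => ?_,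
    hA.comp fun j => .coord _, fun v => by simp [h]⟩
  refine Fin.addCases (fun i => ?_) (fun i => ?_) j
  · simpa using ha i
  · simpa using IsAffine.const 0

theorem sum {τ : Type*} (s : Finset τ) {F : τ → (ι → ℝ) → ℝ} (h : ∀ t ∈ s, IsShallow n (F t)) :
    IsShallow (s.card * n) (fun v => ∑ t ∈ s, F t v) := by
  classical
  induction s using Finset.induction_on with
  | empty => simpa using const 0
  | insert a s ha ih =>
    simp only [Finset.sum_insert ha, Finset.card_insert_of_notMem ha, add_mul, one_mul]
    rw [add_comm]
    exact (h a (Finset.mem_insert_self _ _)).add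
      (ih fun t ht => h t (Finset.mem_insert_of_mem ht))

end IsShallow

/-! ### Composing layers of a fixed width. -/

/-- `Computes S w D F`: on the set `S`, the function `F` agrees with a ReLU network having `D`
hidden layers of exactly `w` neurons each. -/
def Computes {m : ℕ} (S : Set (Fin m → ℝ)) (w : ℕ) :
    ℕ → {κ : Type} → ((Fin m → ℝ) → κ → ℝ) → Prop
  | 0, _, F => ∀ k, ∃ f, IsAffine f ∧ ∀ x ∈ S, F x k = f x
  | D + 1, _, F => ∃ G : (Fin m → ℝ) → Fin w → ℝ, Computes S w D G ∧
      ∀ k, ∃ f, IsAffine f ∧ ∀ x ∈ S, F x k = f (fun j => max 0 (G x j))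

namespace Computes

variable {m : ℕ} {S : Set (Fin m → ℝ)} {w D : ℕ} {κ κ' : Type}
  {F : (Fin m → ℝ) → κ → ℝ} {F' : (Fin m → ℝ) → κ' → ℝ}

theorem input : Computes S w 0 (fun x => x) := fun k => ⟨_, .coord k, fun _ _ => rfl⟩

theorem affine [Fintype κ] (hF : Computes S w D F)
    (h : ∀ k, ∃ g, IsAffine g ∧ ∀ x ∈ S, F' x k = g (F x)) : Computes S w D F' := by
  cases D with
  | zero =>
    intro k
    obtain ⟨g, hg, hk⟩ := h k
    choose f hf hf' using hF
    exact ⟨_, hg.comp hf, fun x hx => by rw [hk x hx]; congr 1; funext j; exact hf' j x hx⟩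
  | succ D =>
    obtain ⟨G, hG, hF⟩ := hF
    refine ⟨G, hG, fun k => ?_⟩
    obtain ⟨g, hg, hk⟩ := h k
    choose f hf hf' using hF
    exact ⟨_, hg.comp hf, fun x hx => by rw [hk x hx]; congr 1; funext j; exact hf' j x hx⟩

theorem coordwise (hF : Computes S w D F)
    (h : ∀ k', (∃ k, ∀ x ∈ S, F' x k' = F x k) ∨ ∀ x ∈ S, F' x k' = 0) :
    Computes S w D F' := by
  cases D with
  | zero =>
    intro k'
    rcases h k' with ⟨k, hk⟩ | hk
    · obtain ⟨f, hf, hf'⟩ := hF k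
      exact ⟨f, hf, fun x hx => by rw [hk x hx, hf' x hx]⟩
    · exact ⟨_, .const 0, hk⟩
  | succ D =>
    obtain ⟨G, hG, hF⟩ := hF
    refine ⟨G, hG, fun k' => ?_⟩
    rcases h k' with ⟨k, hk⟩ | hk
    · obtain ⟨f, hf, hf'⟩ := hF k
      exact ⟨f, hf, fun x hx => by rw [hk x hx, hf' x hx]⟩
    · exact ⟨_, .const 0, hk⟩

theorem congr (hF : Computes S w D F) {F₁ : (Fin m → ℝ) → κ → ℝ}
    (h : ∀ x ∈ S, ∀ k, F₁ x k = F x k) : Computes S w D F₁ :=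
  hF.coordwise fun k => .inl ⟨k, fun x hx => h x hx k⟩

/-- A layer whose hidden neurons are indexed by a finite type of cardinality at most `w`. -/
theorem layer {H : Type} [Fintype H] {G : (Fin m → ℝ) → H → ℝ} (hG : Computes S w D G)
    (hH : Fintype.card H ≤ w)
    (h : ∀ k, ∃ f, IsAffine f ∧ ∀ x ∈ S, F x k = f (fun j => max 0 (G x j))) :
    Computes S w (D + 1) F := by
  classical
  obtain ⟨e⟩ : Nonempty (H ↪ Fin w) := by
    apply Function.Embedding.nonempty_of_card_le; simpa using hH
  -- Surplus neurons receive the input `0`, which brings the layer to width exactly `w`.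
  refine ⟨fun x => Function.extend e (G x) 0, hG.coordwise fun j => ?_, fun k => ?_⟩
  · by_cases hj : ∃ a, e a = j
    · obtain ⟨a, rfl⟩ := hj
      exact .inl ⟨a, fun x _ => e.injective.extend_apply _ _ _⟩
    · exact .inr fun x _ => Function.extend_apply' _ _ _ hj
  · obtain ⟨f, hf, hk⟩ := h k
    refine ⟨fun u => f (fun a => u (e a)), hf.comp fun a => .coord _, fun x hx => ?_⟩
    rw [hk x hx]
    simp only [e.injective.extend_apply]

/-- A layer given by shallow functions of the previous state. -/
theorem step [Fintype κ] [Fintype κ'] (hF : Computes S w D F) (n : κ' → ℕ) (hn : ∑ k, n k ≤ w)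
    (h : ∀ k, ∃ g, IsShallow (n k) g ∧ ∀ x ∈ S, F' x k = g (F x)) :
    Computes S w (D + 1) F' := by
  choose g hg hk using h
  choose a A ha hA hgA using hg
  refine layer (H := Σ k, Fin (n k)) (G := fun x j => a j.1 j.2 (F x))
    (hF.affine fun j => ⟨_, ha j.1 j.2, fun _ _ => rfl⟩) (by simpa using hn) fun k => ?_
  exact ⟨fun u => A k (fun j => u ⟨k, j⟩), (hA k).comp fun j => .coord _, fun x hx => by
    rw [hk k x hx, hgA]⟩

theorem pad [Fintype κ] (hF : Computes S w D F) (hw : Fintype.card κ * 2 ≤ w) (k : ℕ) :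
    Computes S w (D + k) F := by
  induction k with
  | zero => exact hF
  | succ k ih =>
    exact ih.step (fun _ => 2) (by simpa using hw) fun j => ⟨_, .coord j, fun _ _ => rfl⟩

theorem mono (hF : Computes S w D F) {w' : ℕ} (h : w ≤ w') : Computes S w' D F := by
  induction D generalizing κ with
  | zero => exact hF
  | succ D ih =>
    obtain ⟨G, hG, hF⟩ := hF
    exact layer (ih hG) (by simpa using h) hF

theorem sumElim (hF : Computes S w D F) {w' : ℕ} (hF' : Computes S w' D F') :
    Computes S (w + w') D (fun x => Sum.elim (F x) (F' x)) := by
  induction D generalizing κ κ' with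
  | zero =>
    rintro (k | k)
    · exact hF k
    · exact hF' k
  | succ D ih =>
    obtain ⟨G, hG, hF⟩ := hF
    obtain ⟨G', hG', hF'⟩ := hF'
    refine layer (ih hG hG') (by simp) ?_
    rintro (k | k)
    · obtain ⟨f, hf, hk⟩ := hF k
      exact ⟨fun u => f (fun j => u (.inl j)), hf.comp fun j => .coord _, hk⟩
    · obtain ⟨f, hf, hk⟩ := hF' k
      exact ⟨fun u => f (fun j => u (.inr j)), hf.comp fun j => .coord _, hk⟩

theorem zero : Computes S w D (fun _ (_ : κ) => 0) := by
  induction D generalizing κ with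
  | zero => exact fun k => ⟨_, .const 0, fun _ _ => rfl⟩
  | succ D ih => exact ⟨_, ih, fun k => ⟨_, .const 0, fun _ _ => rfl⟩⟩

theorem sum {τ : Type*} (s : Finset τ) {f : τ → (Fin m → ℝ) → ℝ}
    (h : ∀ t ∈ s, Computes S w D (fun x (_ : Unit) => f t x)) :
    Computes S (s.card * w) D (fun x (_ : Unit) => ∑ t ∈ s, f t x) := by
  classical
  induction s using Finset.induction_on with
  | empty => simpa using zero
  | insert a s ha ih =>
    simp only [Finset.sum_insert ha, Finset.card_insert_of_notMem ha, add_mul, one_mul]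
    rw [add_comm]
    refine ((h a (Finset.mem_insert_self _ _)).sumElim
      (ih fun t ht => h t (Finset.mem_insert_of_mem ht))).affine fun k => ?_
    exact ⟨_, (IsAffine.coord (.inl ())).add (.coord (.inr ())), fun x _ => rfl⟩

theorem exists_net_aux {n : ℕ} {F : (Fin m → ℝ) → Fin n → ℝ} (hF : Computes S w D F) :
    ∃ φ : ReLUNet m n, φ.width = (if D = 0 then 0 else w) ∧ φ.depth = D ∧
      ∀ x ∈ S, φ.eval x = F x := by
  induction D generalizing n with
  | zero =>
    choose f hf hk using hF
    choose c b hcb using hf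
    refine ⟨.affine (Matrix.of c) b, rfl, rfl, fun x hx => ?_⟩
    funext k
    rw [hk k x hx, hcb]
    simp [ReLUNet.eval, Matrix.mulVec, dotProduct]
  | succ D ih =>
    obtain ⟨G, hG, hF⟩ := hF
    obtain ⟨φ, hw, hD, hφ⟩ := ih hG
    choose f hf hk using hF
    choose c b hcb using hf
    refine ⟨φ.snoc (Matrix.of c) b, ?_, ?_, fun x hx => ?_⟩
    · rw [ReLUNet.width_snoc, hw]; split_ifs <;> simp_all
    · rw [ReLUNet.depth_snoc, hD]
    · funext k
      rw [ReLUNet.eval_snoc, hk k x hx, hcb, hφ x hx]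
      simp [Matrix.mulVec, dotProduct]

theorem exists_net {n : ℕ} {F : (Fin m → ℝ) → Fin n → ℝ} (hF : Computes S w D F) (hD : D ≠ 0) :
    ∃ φ : ReLUNet m n, φ.width = w ∧ φ.depth = D ∧ ∀ x ∈ S, φ.eval x = F x := by
  simpa [hD] using hF.exists_net_aux

end Computes

/-! ### Digit extraction by steep ramps. -/

/-- For a value with fractional part in `[0, 1 - δ]`: is it at least `0`? -/
noncomputable def ramp (δ z : ℝ) : ℝ := max 0 (z / δ + 1) - max 0 (z / δ)

theorem ramp_of_nonneg {δ z : ℝ} (hδ : 0 < δ) (hz : 0 ≤ z) : ramp δ z = 1 := by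
  have := div_nonneg hz hδ.le
  rw [ramp, max_eq_right (by linarith), max_eq_right this]; ring

theorem ramp_of_le {δ z : ℝ} (hδ : 0 < δ) (hz : z ≤ -δ) : ramp δ z = 0 := by
  have : z / δ ≤ -1 := by rw [div_le_iff₀ hδ]; linarith
  rw [ramp, max_eq_left (by linarith), max_eq_left (by linarith)]; ring

/-- Fractional parts at most `1 - δ` keep the argument out of `(-δ, 0)`, the only place where the
ramp differs from a step function. -/
theorem ramp_natCast_add_sub {δ f : ℝ} (hδ : 0 < δ) (hf0 : 0 ≤ f) (hf1 : f ≤ 1 - δ) (k t : ℕ) :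
    ramp δ ((k : ℝ) + f - t) = if t ≤ k then 1 else 0 := by
  split_ifs with h
  · have : (t : ℝ) ≤ k := by exact_mod_cast h
    exact ramp_of_nonneg hδ (by linarith)
  · have : (k : ℝ) + 1 ≤ t := by exact_mod_cast (not_le.mp h)
    exact ramp_of_le hδ (by linarith)

theorem IsShallow.ramp {ι : Type} [Fintype ι] {f : (ι → ℝ) → ℝ} (δ : ℝ) (hf : IsAffine f) :
    IsShallow 2 (fun v => ramp δ (f v)) :=
  (IsShallow.relu ((hf.div_const δ).add (.const 1))).sub (.relu (hf.div_const δ))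

/-- Remove the leading base-`b` digit, of weight `R`, from `z`. -/
noncomputable def stripDigit (b : ℕ) (R δ z : ℝ) : ℝ :=
  z - R * ∑ i ∈ Finset.range (b - 1), ramp δ (z - (i + 1) * R)

theorem IsShallow.stripDigit {ι : Type} [Fintype ι] {f : (ι → ℝ) → ℝ} {b : ℕ} (hb : 1 ≤ b)
    (R δ : ℝ) (hf : IsAffine f) : IsShallow (2 * b) (fun v => stripDigit b R δ (f v)) := by
  have h := (IsShallow.of_affine hf).sub ((IsShallow.sum (Finset.range (b - 1))
    (F := fun i v => _root_.ramp δ (f v - ((i : ℝ) + 1) * R)) fun i _ =>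
    IsShallow.ramp δ (hf.sub (.const _))).const_mul R)
  refine h.mono ?_
  rw [Finset.card_range]; omega

/-- The ramps count the multiples `R, 2 * R, …, (b - 1) * R` that do not exceed the integer part
`k`. Their number is the leading digit `k / R`, and the fractional part survives untouched. -/
theorem stripDigit_eq {n b R : ℕ} (hb : 1 ≤ b) (hR : 1 ≤ R) {f δ : ℝ} (hδ : 0 < δ) (hf0 : 0 ≤ f)
    (hf1 : f ≤ 1 - δ) :
    stripDigit b R δ ((n % (b * R) : ℕ) + f) = (n % R : ℕ) + f := by
  set k := n % (b * R) with hk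
  have hkR : n % R = k % R := by rw [hk, Nat.mod_mul_left_mod]
  have hklt : k < b * R := Nat.mod_lt _ (by positivity)
  have hkb : k / R ≤ b - 1 := by
    have : k / R < b := Nat.div_lt_of_lt_mul (by rwa [mul_comm])
    omega
  have hsum : ∑ i ∈ Finset.range (b - 1), ramp δ ((k : ℝ) + f - (i + 1) * R) = (k / R : ℕ) := by
    have h1 : ∀ i ∈ Finset.range (b - 1), ramp δ ((k : ℝ) + f - (i + 1) * R) =
        if i < k / R then 1 else 0 := by
      intro i _
      have := ramp_natCast_add_sub hδ hf0 hf1 k ((i + 1) * R)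
      push_cast at this
      rw [this]
      congr 1
      rw [eq_iff_iff, ← Nat.le_div_iff_mul_le (by omega)]
      omega
    rw [Finset.sum_congr rfl h1, Finset.sum_boole]
    congr 1
    rw [show (Finset.range (b - 1)).filter (fun i => i < k / R) = Finset.range (k / R) by
      ext i; simp; omega]
    simp
  rw [stripDigit, hsum, hkR]
  have : ((k % R : ℕ) : ℝ) + R * (k / R : ℕ) = k := by exact_mod_cast Nat.mod_add_div k R
  linarith

/-! ### Approximate squares and products. -/

/-- The zigzag function with `b` monotone pieces on `[0,1]`. -/
noncomputable def zigzag (b : ℕ) (x : ℝ) : ℝ :=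
  max 0 (b * x) + 2 * ∑ k ∈ Finset.range (b - 1), (-1) ^ (k + 1) * max 0 (b * x - (k + 1))

/-- The piecewise linear interpolant of `x - x ^ 2` on `[0,1]` with nodes `k / b`. -/
noncomputable def parabolaInterp (b : ℕ) (x : ℝ) : ℝ :=
  (1 - 1 / b) * max 0 x - 2 / (b * b) * ∑ k ∈ Finset.range (b - 1), max 0 (b * x - (k + 1))

theorem IsShallow.zigzag {ι : Type} [Fintype ι] {f : (ι → ℝ) → ℝ} {b : ℕ} (hb : 1 ≤ b)
    (hf : IsAffine f) : IsShallow b (fun v => zigzag b (f v)) := by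
  have h := (IsShallow.relu (hf.const_mul b)).add ((IsShallow.sum (Finset.range (b - 1))
    (F := fun k v => (-1 : ℝ) ^ (k + 1) * max 0 (b * f v - ((k : ℝ) + 1))) fun k _ =>
    (IsShallow.relu ((hf.const_mul b).sub (.const _))).const_mul _).const_mul 2)
  refine h.mono ?_
  rw [Finset.card_range]; omega

theorem IsShallow.parabolaInterp {ι : Type} [Fintype ι] {f : (ι → ℝ) → ℝ} {b : ℕ} (hb : 1 ≤ b)
    (hf : IsAffine f) : IsShallow b (fun v => parabolaInterp b (f v)) := by
  have h := ((IsShallow.relu hf).const_mul (1 - 1 / b)).sub ((IsShallow.sum (Finset.range (b - 1))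
    (F := fun k v => max 0 (b * f v - ((k : ℝ) + 1))) fun k _ =>
    (IsShallow.relu ((hf.const_mul b).sub (.const _)))).const_mul (2 / (b * b)))
  refine h.mono ?_
  rw [Finset.card_range]; omega

theorem sum_range_mul_relu {n m : ℕ} (hmn : m ≤ n) (c : ℕ → ℝ) {y : ℝ} (h0 : (m : ℝ) ≤ y)
    (h1 : y ≤ m + 1) :
    ∑ k ∈ Finset.range n, c k * max 0 (y - (k + 1)) =
      ∑ k ∈ Finset.range m, c k * (y - (k + 1)) := by
  rw [← Finset.sum_range_add_sum_Ico _ hmn, add_eq_left.mpr, Finset.sum_congr rfl]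
  · intro k hk
    have : (k : ℝ) + 1 ≤ m := by exact_mod_cast Finset.mem_range.mp hk
    rw [max_eq_right (by linarith)]
  · refine Finset.sum_eq_zero fun k hk => ?_
    have : (m : ℝ) ≤ k := by exact_mod_cast (Finset.mem_Ico.mp hk).1
    rw [max_eq_left (by linarith), mul_zero]

theorem sum_range_alternating (m : ℕ) (y : ℝ) :
    y + 2 * ∑ k ∈ Finset.range m, (-1 : ℝ) ^ (k + 1) * (y - (k + 1)) =
      if Even m then y - m else m + 1 - y := by
  induction m with
  | zero => simp
  | succ m ih =>
    rw [Finset.sum_range_succ, mul_add, ← add_assoc, ih]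
    rcases Nat.even_or_odd m with h | h
    · have h' : ¬ Even (m + 1) := by rw [Nat.even_add_one]; simpa using h
      rw [if_pos h, if_neg h', Odd.neg_one_pow h.add_one]
      push_cast; ring
    · have h' : Even (m + 1) := h.add_one
      rw [if_neg (by simpa using h), if_pos h', Even.neg_one_pow h']
      push_cast; ring

theorem sum_range_sub_succ (m : ℕ) (y : ℝ) :
    ∑ k ∈ Finset.range m, (1 : ℝ) * (y - (k + 1)) = m * y - m * (m + 1) / 2 := by
  induction m with
  | zero => simp
  | succ m ih => rw [Finset.sum_range_succ, ih]; push_cast; ring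

/-- On `[m / b, (m + 1) / b]` the parabola exceeds its chord by `t * (1 - t) / b ^ 2`, where `t = b
* x - m`. The zigzag equals `t` or `1 - t`, and `t * (1 - t)` is the same for both, so the error is
a scaled copy of the original function. -/
theorem zigzag_spec {b : ℕ} (hb : 1 ≤ b) {x : ℝ} (h0 : 0 ≤ x) (h1 : x ≤ 1) :
    0 ≤ zigzag b x ∧ zigzag b x ≤ 1 ∧
      x - x ^ 2 = parabolaInterp b x + (zigzag b x - zigzag b x ^ 2) / (b : ℝ) ^ 2 := by
  have hb0 : (0 : ℝ) < b := by exact_mod_cast hb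
  have hy0 : 0 ≤ b * x := by positivity
  have hy1 : b * x ≤ b := by nlinarith
  obtain ⟨m, hm, hm0, hm1⟩ : ∃ m : ℕ, m ≤ b - 1 ∧ (m : ℝ) ≤ b * x ∧ b * x ≤ m + 1 := by
    rcases hy1.lt_or_eq with h | h
    · refine ⟨⌊b * x⌋₊, ?_, Nat.floor_le hy0, (Nat.lt_floor_add_one _).le⟩
      have := (Nat.floor_lt hy0).mpr h
      omega
    · refine ⟨b - 1, le_rfl, ?_, ?_⟩ <;> rw [h] <;> push_cast [Nat.cast_sub hb] <;> linarith
  have hz : zigzag b x = if Even m then b * x - m else m + 1 - b * x := by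
    rw [zigzag, max_eq_right hy0, sum_range_mul_relu hm (fun k => (-1) ^ (k + 1)) hm0 hm1,
      sum_range_alternating]
  have hp : parabolaInterp b x =
      (1 - 1 / b) * x - 2 / (b * b) * (m * (b * x) - m * (m + 1) / 2) := by
    have := sum_range_mul_relu hm (fun _ => 1) hm0 hm1
    simp only [one_mul] at this
    rw [parabolaInterp, max_eq_right h0, this]
    rw [← sum_range_sub_succ]; simp only [one_mul]
  refine ⟨?_, ?_, ?_⟩
  · rw [hz]; split_ifs <;> linarith
  · rw [hz]; split_ifs <;> linarith
  · rw [hz, hp]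
    split_ifs <;> field_simp <;> ring

/-- Approximation of `x - x ^ 2` by iterated zigzags with numbers of pieces `bs`. -/
noncomputable def parabolaApprox : List ℕ → ℝ → ℝ
  | [], _ => 0
  | b :: bs, x => parabolaInterp b x + parabolaApprox bs (zigzag b x) / (b : ℝ) ^ 2

/-- Each stage divides the remaining error by `b ^ 2`; the final one is at most `1 / 4`, the maximum
of `x - x ^ 2`. -/
theorem parabolaApprox_spec (bs : List ℕ) (hbs : ∀ b ∈ bs, 1 ≤ b) {x : ℝ} (h0 : 0 ≤ x)
    (h1 : x ≤ 1) : 0 ≤ x - x ^ 2 - parabolaApprox bs x ∧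
      x - x ^ 2 - parabolaApprox bs x ≤ 1 / (4 * (bs.prod : ℝ) ^ 2) := by
  induction bs generalizing x with
  | nil =>
    simp only [parabolaApprox, List.prod_nil, Nat.cast_one]
    constructor <;> nlinarith [sq_nonneg (x - 1 / 2)]
  | cons b bs ih =>
    have hb : 1 ≤ b := hbs b (by simp)
    have hb0 : (0 : ℝ) < b := by exact_mod_cast hb
    obtain ⟨hz0, hz1, hz⟩ := zigzag_spec hb h0 h1
    obtain ⟨i0, i1⟩ := ih (fun c hc => hbs c (by simp [hc])) hz0 hz1
    have e : x - x ^ 2 - parabolaApprox (b :: bs) x =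
        (zigzag b x - zigzag b x ^ 2 - parabolaApprox bs (zigzag b x)) / (b : ℝ) ^ 2 := by
      rw [parabolaApprox, hz]; ring
    rw [e]
    refine ⟨by positivity, ?_⟩
    calc _ ≤ 1 / (4 * (bs.prod : ℝ) ^ 2) / (b : ℝ) ^ 2 := by gcongr
      _ = _ := by rw [List.prod_cons]; push_cast; rw [div_div]; ring_nf

/-- Approximate product of two numbers in `[-1,1]`. -/
noncomputable def mulApprox (bs : List ℕ) (c h : ℝ) : ℝ :=
  4 * (parabolaApprox bs ((c - h + 2) / 4) - parabolaApprox bs ((c + h + 2) / 4))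

/-- Polarisation: for `g x = x - x ^ 2`, the linear terms cancel in `4 * (g ((c - h + 2) / 4) - g
((c + h + 2) / 4)) = c * h`, and the shift by `2` puts both arguments in `[0, 1]`. The two errors
have the same sign, so their difference is no larger than the bound for one of them. -/
theorem abs_mulApprox_sub_le (bs : List ℕ) (hbs : ∀ b ∈ bs, 1 ≤ b) {c h : ℝ} (hc : |c| ≤ 1)
    (hh : |h| ≤ 1) : |mulApprox bs c h - c * h| ≤ 1 / (bs.prod : ℝ) ^ 2 := by
  rw [abs_le] at hc hh
  obtain ⟨u0, u1⟩ := parabolaApprox_spec bs hbs (x := (c - h + 2) / 4) (by linarith) (by linarith)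
  obtain ⟨v0, v1⟩ := parabolaApprox_spec bs hbs (x := (c + h + 2) / 4) (by linarith) (by linarith)
  have e : 1 / (4 * (bs.prod : ℝ) ^ 2) = 1 / (bs.prod : ℝ) ^ 2 / 4 := by
    rw [div_div, mul_comm]
  rw [e] at u1 v1
  rw [mulApprox, abs_le]
  constructor <;> nlinarith

theorem List.abs_prod_map_le_one {κ : Type*} {c : κ → ℝ} (hc : ∀ k, |c k| ≤ 1) (l : List κ) :
    |(l.map c).prod| ≤ 1 := by
  induction l with
  | nil => simp
  | cons a l ih =>
    rw [List.map_cons, List.prod_cons, abs_mul]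
    exact mul_le_one₀ (hc a) (abs_nonneg _) ih

namespace Computes

variable {m : ℕ} {S : Set (Fin m → ℝ)} {w D : ℕ} {κ τ : Type} [Fintype κ] [Fintype τ]
  {C : (Fin m → ℝ) → κ → ℝ}

/-- A base larger than the width allows is factored as `bs.prod`, and its digit is removed one small
mixed-radix digit per layer. -/
theorem stripDigits {n : (Fin m → ℝ) → τ → ℕ} {f : (Fin m → ℝ) → τ → ℝ} {δ : ℝ} (hδ : 0 < δ)
    (hf0 : ∀ x ∈ S, ∀ i, 0 ≤ f x i) (hf1 : ∀ x ∈ S, ∀ i, f x i ≤ 1 - δ) {B R : ℕ} (hR : 1 ≤ R)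
    (hw : Fintype.card κ * 2 + Fintype.card τ * (2 * B) ≤ w) (bs : List ℕ)
    (hbs : ∀ b ∈ bs, 1 ≤ b ∧ b ≤ B)
    (hF : Computes S w D (fun x => Sum.elim (C x)
      (fun i => ((n x i % (bs.prod * R) : ℕ) : ℝ) + f x i))) :
    Computes S w (D + bs.length) (fun x => Sum.elim (C x)
      (fun i => ((n x i % R : ℕ) : ℝ) + f x i)) := by
  induction bs generalizing D with
  | nil => simpa using hF
  | cons b bs ih =>
    have hb := hbs b (by simp)
    have hprod : 1 ≤ bs.prod := List.one_le_prod fun c hc => (hbs c (by simp [hc])).1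
    rw [List.length_cons, add_comm bs.length, ← add_assoc]
    refine ih (fun c hc => hbs c (by simp [hc])) ?_
    refine hF.step (Sum.elim (fun _ => 2) (fun _ => 2 * B)) (by simpa using hw) ?_
    rintro (k | i)
    · exact ⟨_, .coord (.inl k), fun x _ => rfl⟩
    · refine ⟨_, (IsShallow.stripDigit hb.1 (bs.prod * R : ℕ) δ
        (.coord (.inr i))).mono (by simp; omega), fun x hx => ?_⟩
      simp only [Sum.elim_inr, List.prod_cons, mul_assoc]
      rw [stripDigit_eq hb.1 (Nat.mul_pos hprod hR) hδ (hf0 x hx i) (hf1 x hx i)]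

/-- Both arguments are iterated through the zigzags while `a` accumulates the difference of the
interpolants; `wt` carries the factors `1 / b ^ 2` met so far. -/
theorem parabolaApprox {u v a : (Fin m → ℝ) → ℝ} {B : ℕ} (wt : ℝ)
    (hw : Fintype.card κ * 2 + (4 * B + 2) ≤ w) (bs : List ℕ) (hbs : ∀ b ∈ bs, 1 ≤ b ∧ b ≤ B)
    (hF : Computes S w D (fun x => Sum.elim (C x) ![u x, v x, a x])) :
    Computes S w (D + bs.length) (fun x => Sum.elim (C x) (fun _ : Unit =>
      a x + wt * (_root_.parabolaApprox bs (u x) - _root_.parabolaApprox bs (v x)))) := by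
  induction bs generalizing D u v a wt with
  | nil =>
    refine hF.affine ?_
    rintro (k | k)
    · exact ⟨_, .coord (.inl k), fun x _ => rfl⟩
    · exact ⟨_, .coord (.inr 2), fun x _ => by simp [_root_.parabolaApprox]⟩
  | cons b bs ih =>
    have hb := hbs b (by simp)
    rw [List.length_cons, add_comm bs.length, ← add_assoc]
    have := ih (D := D + 1) (u := fun x => zigzag b (u x)) (v := fun x => zigzag b (v x))
      (a := fun x => a x + wt * (parabolaInterp b (u x) - parabolaInterp b (v x)))
      (wt / (b : ℝ) ^ 2) (fun c hc => hbs c (by simp [hc])) ?_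
    · refine this.congr ?_
      rintro x _ (k | k)
      · rfl
      · simp only [Sum.elim_inr, _root_.parabolaApprox]; ring
    · refine hF.step (Sum.elim (fun _ => 2) ![B, B, 2 + (B + B)]) ?_ ?_
      · simp [Fin.sum_univ_succ]; omega
      rintro (k | k)
      · exact ⟨_, .coord (.inl k), fun x _ => rfl⟩
      fin_cases k
      · exact ⟨_, (IsShallow.zigzag hb.1 (.coord (.inr 0))).mono hb.2, fun x _ => rfl⟩
      · exact ⟨_, (IsShallow.zigzag hb.1 (.coord (.inr 1))).mono hb.2, fun x _ => rfl⟩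
      · exact ⟨_, (IsShallow.coord (.inr 2)).add
          ((((IsShallow.parabolaInterp hb.1 (.coord (.inr 0))).mono hb.2).sub
          ((IsShallow.parabolaInterp hb.1 (.coord (.inr 1))).mono hb.2)).const_mul wt),
          fun x _ => rfl⟩

theorem mulApprox {c : (Fin m → ℝ) → ℝ} {B : ℕ} (hw : Fintype.card κ * 2 + (4 * B + 2) ≤ w)
    (bs : List ℕ) (hbs : ∀ b ∈ bs, 1 ≤ b ∧ b ≤ B) (i : κ)
    (hF : Computes S w D (fun x => Sum.elim (C x) (fun _ : Unit => c x))) :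
    Computes S w (D + bs.length) (fun x => Sum.elim (C x) (fun _ : Unit =>
      _root_.mulApprox bs (c x) (C x i))) := by
  have h := parabolaApprox (u := fun x => (c x - C x i + 2) / 4)
    (v := fun x => (c x + C x i + 2) / 4) (a := fun _ => 0) 4 hw bs hbs (D := D) (C := C) (S := S)
    (hF.affine ?_)
  · exact h.congr (by rintro x _ (k | k) <;> simp [_root_.mulApprox])
  · rintro (k | k)
    · exact ⟨_, .coord (.inl k), fun x _ => rfl⟩
    fin_cases k
    · exact ⟨_, (((IsAffine.coord (.inr ())).sub (.coord (.inl i))).add (.const 2)).div_const 4,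
        fun x _ => rfl⟩
    · exact ⟨_, (((IsAffine.coord (.inr ())).add (.coord (.inl i))).add (.const 2)).div_const 4,
        fun x _ => rfl⟩
    · exact ⟨_, .const 0, fun x _ => rfl⟩

/-- Factors are multiplied in one at a time. Factors bounded by `1 / 2` and an error of at most `1 /
2` per product keep the running value in `[-1, 1]`, where the product approximation is valid, so the
errors just add up. -/
theorem monomial {c : (Fin m → ℝ) → ℝ} {B : ℕ} (hw : Fintype.card κ * 2 + (4 * B + 2) ≤ w)
    (bs : List ℕ) (hbs : ∀ b ∈ bs, 1 ≤ b ∧ b ≤ B) (hprod : 2 ≤ bs.prod)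
    (hC : ∀ x ∈ S, ∀ i, |C x i| ≤ 1 / 2) (hc : ∀ x ∈ S, |c x| ≤ 1) (l : List κ)
    (hF : Computes S w D (fun x => Sum.elim (C x) (fun _ : Unit => c x))) :
    ∃ c' : (Fin m → ℝ) → ℝ,
      Computes S w (D + l.length * bs.length) (fun x => Sum.elim (C x) (fun _ : Unit => c' x)) ∧
      ∀ x ∈ S, |c' x - c x * (l.map (C x)).prod| ≤ l.length / (bs.prod : ℝ) ^ 2 := by
  induction l generalizing c D with
  | nil => exact ⟨c, by simpa using hF, by simp⟩
  | cons i l ih =>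
    have hbs' : ∀ b ∈ bs, 1 ≤ b := fun b hb => (hbs b hb).1
    have hε : 1 / (bs.prod : ℝ) ^ 2 ≤ 1 / 2 := by
      have : (2 : ℝ) ≤ bs.prod := by exact_mod_cast hprod
      apply one_div_le_one_div_of_le <;> nlinarith
    have herr : ∀ x ∈ S, |_root_.mulApprox bs (c x) (C x i) - c x * C x i| ≤
        1 / (bs.prod : ℝ) ^ 2 := fun x hx =>
      abs_mulApprox_sub_le bs hbs' (hc x hx) ((hC x hx i).trans (by norm_num))
    obtain ⟨c', h1, h2⟩ := ih (c := fun x => _root_.mulApprox bs (c x) (C x i))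
      (fun x hx => by
        have h1 := herr x hx
        have h2 : |c x * C x i| ≤ 1 / 2 := by
          rw [abs_mul]
          have := mul_le_mul (hc x hx) (hC x hx i) (abs_nonneg _) zero_le_one
          linarith
        rw [abs_le] at *
        constructor <;> linarith) (hF.mulApprox hw bs hbs i)
    refine ⟨c', by convert h1 using 1; rw [List.length_cons]; ring, fun x hx => ?_⟩
    have hp : |(l.map (C x)).prod| ≤ 1 := 
      List.abs_prod_map_le_one (fun a => (hC x hx a).trans (by norm_num)) l
    have e : c' x - c x * ((i :: l).map (C x)).prod =
        (c' x - _root_.mulApprox bs (c x) (C x i) * (l.map (C x)).prod) +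
        (_root_.mulApprox bs (c x) (C x i) - c x * C x i) * (l.map (C x)).prod := by
      rw [List.map_cons, List.prod_cons]; ring
    rw [e]
    refine (abs_add_le _ _).trans ?_
    rw [abs_mul, List.length_cons]
    rw [Nat.cast_succ, add_div]
    refine add_le_add (h2 x hx) ?_
    exact (mul_le_mul (herr x hx) hp (abs_nonneg _) (by positivity)).trans (by simp)

end Computes

/-! ### Table lookup by bit extraction. -/

/-- Indicator that the digit of weight `R` of the natural number `z` is `i`. -/
noncomputable def digitIndicator (R : ℝ) (i : ℕ) (z : ℝ) : ℝ :=
  ramp 1 (z - i * R) - ramp 1 (z - (i + 1) * R)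

theorem digitIndicator_natCast {R : ℕ} (hR : 1 ≤ R) (i k : ℕ) :
    digitIndicator R i (k : ℝ) = if k / R = i then 1 else 0 := by
  have h1 := ramp_natCast_add_sub one_pos le_rfl (by norm_num) (f := 0) k (i * R)
  have h2 := ramp_natCast_add_sub one_pos le_rfl (by norm_num) (f := 0) k ((i + 1) * R)
  push_cast at h1 h2
  rw [add_zero] at h1 h2
  simp only [digitIndicator, h1, h2, ← Nat.le_div_iff_mul_le (Nat.lt_of_lt_of_le one_pos hR)]
  split_ifs <;> first | omega | norm_num

theorem IsShallow.digitIndicator {ι : Type} [Fintype ι] {f : (ι → ℝ) → ℝ} (R : ℝ) (i : ℕ)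
    (hf : IsAffine f) : IsShallow 4 (fun v => digitIndicator R i (f v)) :=
  (IsShallow.ramp 1 (hf.sub (.const _))).sub (IsShallow.ramp 1 (hf.sub (.const _)))

/-- The number with base-`A` digits `v 0, …, v (j - 1)`, least significant first. -/
def encodeDigits (A : ℕ) (v : ℕ → ℕ) (j : ℕ) : ℕ := ∑ i ∈ Finset.range j, v i * A ^ i

theorem encodeDigits_lt {A : ℕ} {v : ℕ → ℕ} (hv : ∀ i, v i < A) (j : ℕ) :
    encodeDigits A v j < A ^ j := by
  induction j with
  | zero => simp [encodeDigits]
  | succ j ih =>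
    rw [encodeDigits, Finset.sum_range_succ]
    change encodeDigits A v j + _ < _
    have : (v j + 1) * A ^ j ≤ A * A ^ j := Nat.mul_le_mul_right _ (hv j)
    rw [pow_succ, mul_comm (A ^ j)]
    linarith

theorem encodeDigits_mod {A : ℕ} {v : ℕ → ℕ} (hv : ∀ i, v i < A) {j J : ℕ} (h : j ≤ J) :
    encodeDigits A v J % A ^ j = encodeDigits A v j := by
  induction J, h using Nat.le_induction with
  | base => exact Nat.mod_eq_of_lt (encodeDigits_lt hv j)
  | succ J hJ ih =>
    rw [encodeDigits, Finset.sum_range_succ]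
    change (encodeDigits A v J + _) % _ = _
    obtain ⟨c, hc⟩ := pow_dvd_pow A hJ
    rw [hc, show v J * (A ^ j * c) = A ^ j * (v J * c) by ring, Nat.add_mul_mod_self_left, ih]

namespace Computes

variable {m : ℕ} {S : Set (Fin m → ℝ)} {w D : ℕ} {κ : Type} [Fintype κ]
  {C : (Fin m → ℝ) → κ → ℝ}

/-- The leading digit is stored as `N` indicators so that a table can later be read by a linear form
in them. The value is an integer, so ramps of width `1` are already exact. -/
theorem splitDigit {n : (Fin m → ℝ) → ℕ} {N R : ℕ} (hN : 1 ≤ N) (hR : 1 ≤ R)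
    (hn : ∀ x ∈ S, n x < N * R) (hw : Fintype.card κ * 2 + 6 * N ≤ w)
    (hF : Computes S w D (fun x => Sum.elim (C x) (fun _ : Unit => (n x : ℝ)))) :
    Computes S w (D + 1) (fun x => Sum.elim
      (Sum.elim (C x) (fun i : Fin N => if n x / R = i then (1 : ℝ) else 0))
      (fun _ : Unit => ((n x % R : ℕ) : ℝ))) := by
  refine hF.step (Sum.elim (Sum.elim (fun _ => 2) (fun _ => 4)) (fun _ => 2 * N)) ?_ ?_
  · simp; omega
  rintro ((k | i) | k)
  · exact ⟨_, .coord (.inl k), fun x _ => rfl⟩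
  · exact ⟨_, .digitIndicator R i (.coord (.inr ())), fun x _ => by
      simp [digitIndicator_natCast hR]⟩
  · refine ⟨_, .stripDigit hN R 1 (.coord (.inr ())), fun x hx => ?_⟩
    have := stripDigit_eq (n := n x) hN hR one_pos (le_refl (0 : ℝ)) (by norm_num)
    rw [Nat.mod_eq_of_lt (hn x hx), add_zero, add_zero] at this
    exact this.symm

/-- Layer `t` holds the slice `Y · · t` in its weights: `q` is resolved by a linear form, `p` by a
choice among `N` neurons, and `ρ / M` by the time at which the layer fires. Thus `N * N * M`
integers are stored with width of order `N` and `M + 1` layers. -/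
theorem fetch {p q ρ : (Fin m → ℝ) → ℕ} {N M : ℕ} (hM : 1 ≤ M) (hp : ∀ x ∈ S, p x < N)
    (hq : ∀ x ∈ S, q x < N) (hρ : ∀ x ∈ S, ρ x < M * M) (Y : ℕ → ℕ → ℕ → ℕ)
    (hw : Fintype.card κ * 2 + (5 * N + 12) ≤ w)
    (hF : Computes S w D (fun x => Sum.elim
      (Sum.elim (Sum.elim (C x) (fun i : Fin N => if p x = i then (1 : ℝ) else 0))
        (fun i : Fin N => if q x = i then (1 : ℝ) else 0)) (fun _ : Unit => (ρ x : ℝ)))) :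
    Computes S w (D + (M + 1)) (fun x => Sum.elim (C x)
      ![((ρ x % M : ℕ) : ℝ), (Y (p x) (q x) (ρ x / M) : ℝ)]) := by
  obtain ⟨b, hb⟩ : ∃ b : ℕ, ∀ (i k : Fin N) (t : Fin M), Y i k t ≤ b := by
    refine ⟨∑ i : Fin N, ∑ k : Fin N, ∑ t : Fin M, Y i k t, fun i k t => ?_⟩
    refine le_trans ?_ (Finset.single_le_sum (f := fun i : Fin N => ∑ k : Fin N, ∑ t : Fin M,
      Y i k t) (fun _ _ => Nat.zero_le _) (Finset.mem_univ i))
    refine le_trans ?_ (Finset.single_le_sum (f := fun k : Fin N => ∑ t : Fin M,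
      Y i k t) (fun _ _ => Nat.zero_le _) (Finset.mem_univ k))
    exact Finset.single_le_sum (f := fun t : Fin M =>
      Y i k t) (fun _ _ => Nat.zero_le _) (Finset.mem_univ t)
  -- The third entry records the integer once its turn has come; the fourth loses `M * (ρ / M)` at
  -- that moment, leaving `ρ % M`.
  have loop : ∀ t ≤ M, Computes S w (D + 1 + t) (fun x => Sum.elim
      (Sum.elim (Sum.elim (C x) (fun i : Fin N => if p x = i then (1 : ℝ) else 0))
        (fun i : Fin N => if q x = i then (1 : ℝ) else 0))
      ![(ρ x : ℝ), if ρ x / M = t then 1 else 0,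
        if ρ x / M < t then (Y (p x) (q x) (ρ x / M) : ℝ) else 0,
        (ρ x : ℝ) - if ρ x / M < t then (M : ℝ) * (ρ x / M : ℕ) else 0]) := by
    intro t
    induction t with
    | zero =>
      intro _
      refine hF.step (Sum.elim (fun _ => 2) ![2, 4, 0, 2]) ?_ ?_
      · simp [Fin.sum_univ_succ]; omega
      rintro (k | k)
      · exact ⟨_, .coord (.inl k), fun x _ => rfl⟩
      fin_cases k
      · exact ⟨_, .coord (.inr ()), fun x _ => rfl⟩
      · exact ⟨_, .digitIndicator M 0 (.coord (.inr ())), fun x _ => by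
          simp [digitIndicator_natCast hM]⟩
      · exact ⟨_, .const 0, fun x _ => by simp⟩
      · exact ⟨_, .coord (.inr ()), fun x _ => by simp⟩
    | succ t ih =>
      intro ht
      refine (ih (by omega)).step (Sum.elim (fun _ => 2) ![2, 4, 2 + N * 1, 2]) ?_ ?_
      · simp [Fin.sum_univ_succ]; omega
      rintro (k | k)
      · exact ⟨_, .coord (.inl k), fun x _ => rfl⟩
      fin_cases k
      · exact ⟨_, .coord (.inr 0), fun x _ => rfl⟩
      · exact ⟨_, .digitIndicator M (t + 1) (.coord (.inr 0)), fun x _ => by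
          simp [digitIndicator_natCast hM]⟩
      -- With `Y ≤ b`, the offset `- 2 * b` makes neuron `i` vanish unless both indicators `p = i`
      -- and `ρ / M = t` equal `1`; then it returns `Y i (q x) t`.
      · have hs := IsShallow.sum (Finset.univ : Finset (Fin N)) (n := 1)
          (F := fun i (v : ((κ ⊕ Fin N) ⊕ Fin N) ⊕ Fin 4 → ℝ) =>
            max 0 (∑ k : Fin N, (Y i k t : ℝ) * v (.inl (.inr k)) +
              (b : ℝ) * v (.inl (.inl (.inr i))) + b * v (.inr 1) - 2 * b)) fun i _ =>
          .relu ((((IsAffine.sum _ fun k _ => (IsAffine.coord _).const_mul _).add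
            ((IsAffine.coord _).const_mul _)).add ((IsAffine.coord _).const_mul _)).sub
            (.const _))
        rw [Finset.card_univ, Fintype.card_fin] at hs
        refine ⟨_, (IsShallow.coord (.inr 2)).add hs, fun x hx => ?_⟩
        have hY : ∀ i : Fin N, ∑ k : Fin N, (Y i k t : ℝ) * (if q x = k then (1 : ℝ) else 0) =
            Y i (q x) t := by
          intro i
          rw [Finset.sum_eq_single (⟨q x, hq x hx⟩ : Fin N)]
          · simp
          · intro k _ hk
            rw [if_neg, mul_zero]
            intro h
            exact hk (Fin.ext h.symm)
          · simp
        have hb' : ∀ i : Fin N, (Y i (q x) t : ℝ) ≤ b := fun i => by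
          exact_mod_cast hb i ⟨q x, hq x hx⟩ ⟨t, by omega⟩
        have hsum : ∑ i : Fin N, max 0 ((Y i (q x) t : ℝ) +
            (b : ℝ) * (if p x = i then (1 : ℝ) else 0) +
            b * (if ρ x / M = t then 1 else 0) - 2 * b) =
            if ρ x / M = t then (Y (p x) (q x) (ρ x / M) : ℝ) else 0 := by
          rw [Finset.sum_eq_single (⟨p x, hp x hx⟩ : Fin N)]
          · have h1 := hb' ⟨p x, hp x hx⟩
            have h2 : (0 : ℝ) ≤ Y (p x) (q x) t := by positivity
            simp only at h1
            by_cases h : ρ x / M = t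
            · rw [if_pos h, if_pos h, if_pos rfl, max_eq_right (by linarith), h]; ring
            · rw [if_neg h, if_neg h, if_pos rfl, max_eq_left (by linarith)]
          · intro i _ hi
            have h1 := hb' i
            have h0 : (0 : ℝ) ≤ b := by positivity
            rw [if_neg (fun h => hi (Fin.ext h.symm)), max_eq_left]
            split_ifs <;> linarith
          · simp
        simp only [Sum.elim_inl, Sum.elim_inr, hY]
        change (if ρ x / M < t + 1 then (Y (p x) (q x) (ρ x / M) : ℝ) else 0) =
          (if ρ x / M < t then (Y (p x) (q x) (ρ x / M) : ℝ) else 0) + ∑ i : Fin N,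
            max 0 ((Y i (q x) t : ℝ) + (b : ℝ) * (if p x = i then (1 : ℝ) else 0) +
            b * (if ρ x / M = t then 1 else 0) - 2 * b)
        rw [hsum]
        split_ifs <;> first | omega | simp
      · refine ⟨_, .of_affine ((IsAffine.coord (.inr 3)).sub
          ((IsAffine.coord (.inr 1)).const_mul (M * t))), fun x hx => ?_⟩
        change (ρ x : ℝ) - (if ρ x / M < t + 1 then (M : ℝ) * (ρ x / M : ℕ) else 0) =
          (ρ x : ℝ) - (if ρ x / M < t then (M : ℝ) * (ρ x / M : ℕ) else 0) -
            M * t * (if ρ x / M = t then 1 else 0)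
        split_ifs with h1 h2 h3 h4 h5 <;> first | omega | simp [*]
  have h := loop M le_rfl
  rw [add_assoc, add_comm 1] at h
  refine h.affine ?_
  rintro (k | k)
  · exact ⟨_, .coord (.inl (.inl (.inl k))), fun x _ => rfl⟩
  have hlt : ∀ x ∈ S, ρ x / M < M := fun x hx => Nat.div_lt_of_lt_mul (hρ x hx)
  fin_cases k
  · refine ⟨_, .coord (.inr 3), fun x hx => ?_⟩
    have : ((ρ x % M : ℕ) : ℝ) + M * (ρ x / M : ℕ) = ρ x := by
      exact_mod_cast Nat.mod_add_div _ _
    change ((ρ x % M : ℕ) : ℝ) = (ρ x : ℝ) - if ρ x / M < M then (M : ℝ) * (ρ x / M : ℕ) else 0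
    rw [if_pos (hlt x hx)]
    linarith
  · refine ⟨_, .coord (.inr 2), fun x hx => ?_⟩
    change (Y (p x) (q x) (ρ x / M) : ℝ) =
      if ρ x / M < M then (Y (p x) (q x) (ρ x / M) : ℝ) else 0
    rw [if_pos (hlt x hx)]

/-- The digits of `y` are peeled from the top. At time `u = l` the remainder, read as a fraction, is
saved: its leading base-`bs.prod` digit is the wanted one, and the lower digits are tolerated as
error. -/
theorem selectBlock {l y : (Fin m → ℝ) → ℕ} {M B : ℕ} (bs : List ℕ)
    (hbs : ∀ b ∈ bs, 1 ≤ b ∧ b ≤ B) (hl : ∀ x ∈ S, l x < M)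
    (hy : ∀ x ∈ S, y x < bs.prod ^ M) (hw : Fintype.card κ * 2 + (2 * B + 9) ≤ w)
    (hF : Computes S w D (fun x => Sum.elim (C x) ![(l x : ℝ), (y x : ℝ)])) :
    Computes S w (D + M * (2 + bs.length)) (fun x => Sum.elim (C x) (fun _ : Unit =>
      ((y x % bs.prod ^ (M - l x) : ℕ) : ℝ) / (bs.prod : ℝ) ^ (M - l x))) := by
  have hA : 1 ≤ bs.prod := List.one_le_prod fun c hc => (hbs c hc).1
  have hA' : (0 : ℝ) < bs.prod := by exact_mod_cast hA
  have loop : ∀ u ≤ M, Computes S w (D + u * (2 + bs.length)) (fun x => Sum.elim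
      (Sum.elim (C x) ![(l x : ℝ), if l x < u then
        ((y x % bs.prod ^ (M - l x) : ℕ) : ℝ) / (bs.prod : ℝ) ^ (M - l x) else 0])
      (fun _ : Unit => ((y x % bs.prod ^ (M - u) : ℕ) : ℝ) + 0)) := by
    intro u
    induction u with
    | zero =>
      intro _
      rw [zero_mul, add_zero]
      refine hF.affine ?_
      rintro ((k | k) | k)
      · exact ⟨_, .coord (.inl k), fun x _ => rfl⟩
      · fin_cases k
        · exact ⟨_, .coord (.inr 0), fun x _ => rfl⟩
        · exact ⟨_, .const 0, fun x _ => by simp⟩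
      · exact ⟨_, .coord (.inr 1), fun x hx => by
          simp [Nat.mod_eq_of_lt (hy x hx)]⟩
    | succ u ih =>
      intro hu
      have h1 : Computes S w (D + u * (2 + bs.length) + 1) (fun x => Sum.elim
          (Sum.elim (C x) ![(l x : ℝ), if l x < u then
            ((y x % bs.prod ^ (M - l x) : ℕ) : ℝ) / (bs.prod : ℝ) ^ (M - l x) else 0,
            |(l x : ℝ) - u|])
          (fun _ : Unit => ((y x % bs.prod ^ (M - u) : ℕ) : ℝ))) := by
        refine (ih (by omega)).step (Sum.elim (fun _ => 2) (fun _ => 2)) ?_ ?_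
        · simp; omega
        rintro ((k | k) | k)
        · exact ⟨_, .coord (.inl (.inl k)), fun x _ => rfl⟩
        · fin_cases k
          · exact ⟨_, .coord (.inl (.inr 0)), fun x _ => rfl⟩
          · exact ⟨_, .coord (.inl (.inr 1)), fun x _ => rfl⟩
          · refine ⟨_, (IsShallow.relu ((IsAffine.coord (.inl (.inr 0))).sub (.const u))).add
              (.relu (((IsAffine.coord (.inl (.inr 0))).sub (.const u)).neg)), fun x _ => ?_⟩
            change |(l x : ℝ) - u| = max 0 ((l x : ℝ) - u) + max 0 (-((l x : ℝ) - u))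
            rcases le_total 0 ((l x : ℝ) - u) with h | h
            · rw [abs_of_nonneg h, max_eq_right h, max_eq_left (by linarith), add_zero]
            · rw [abs_of_nonpos h, max_eq_left h, max_eq_right (by linarith), zero_add]
        · exact ⟨_, .coord (.inr ()), fun x hx => by simp⟩
      have h2 : Computes S w (D + u * (2 + bs.length) + 1 + 1) (fun x => Sum.elim
          (Sum.elim (C x) ![(l x : ℝ), if l x < u + 1 then
            ((y x % bs.prod ^ (M - l x) : ℕ) : ℝ) / (bs.prod : ℝ) ^ (M - l x) else 0])
          (fun _ : Unit => ((y x % (bs.prod * bs.prod ^ (M - (u + 1))) : ℕ) : ℝ) + 0)) := by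
        refine h1.step (Sum.elim (Sum.elim (fun _ => 2) (fun _ => 3)) (fun _ => 2)) ?_ ?_
        · simp; omega
        rintro ((k | k) | k)
        · exact ⟨_, .coord (.inl (.inl k)), fun x _ => rfl⟩
        · fin_cases k
          · exact ⟨_, (IsShallow.coord (.inl (.inr 0))).mono (by simp), fun x _ => rfl⟩
          · refine ⟨_, (IsShallow.coord (.inl (.inr 1))).add (.relu
              (((IsAffine.coord (.inr ())).div_const ((bs.prod : ℝ) ^ (M - u))).sub
                (.coord (.inl (.inr 2))))), fun x _ => ?_⟩
            change (if l x < u + 1 then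
              ((y x % bs.prod ^ (M - l x) : ℕ) : ℝ) / (bs.prod : ℝ) ^ (M - l x) else 0) =
              (if l x < u then
              ((y x % bs.prod ^ (M - l x) : ℕ) : ℝ) / (bs.prod : ℝ) ^ (M - l x) else 0) +
              max 0 (((y x % bs.prod ^ (M - u) : ℕ) : ℝ) / (bs.prod : ℝ) ^ (M - u) -
                |(l x : ℝ) - u|)
            -- The fraction lies in `[0, 1]` while `|l - u|` is `0` at the right time and at least
            -- `1` otherwise, so the neuron is an exact gate.
            rcases eq_or_ne (l x) u with h | h
            · rw [if_pos (by omega), if_neg (by omega), h, sub_self, abs_zero, sub_zero,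
                max_eq_right (by positivity), zero_add]
            · have hle : ((y x % bs.prod ^ (M - u) : ℕ) : ℝ) / (bs.prod : ℝ) ^ (M - u) ≤ 1 := by
                rw [div_le_one (by positivity)]
                exact_mod_cast (Nat.mod_lt _ (by positivity)).le
              have habs : (1 : ℝ) ≤ |(l x : ℝ) - u| := by
                have : (1 : ℤ) ≤ |(l x : ℤ) - u| := Int.one_le_abs (by omega)
                exact_mod_cast this
              rw [max_eq_left (by linarith), add_zero]
              congr 1
              rw [eq_iff_iff]; omega
        · refine ⟨_, .coord (.inr ()), fun x hx => ?_⟩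
          rw [← pow_succ', show M - (u + 1) + 1 = M - u by omega]
          simp
      have h3 := stripDigits (n := fun x _ => y x) (f := fun _ _ => 0) one_pos
        (fun _ _ _ => le_rfl) (fun _ _ _ => by norm_num) (Nat.one_le_pow _ _ hA)
        (by simp; omega) bs hbs h2
      convert h3 using 1
      ring
  refine (loop M le_rfl).affine ?_
  rintro (k | k)
  · exact ⟨_, .coord (.inl (.inl k)), fun x _ => rfl⟩
  · refine ⟨_, .coord (.inl (.inr 1)), fun x hx => ?_⟩
    simp [hl x hx]

/-- Lookup of `ξ (θ x)` for an arbitrary table `ξ` of `(N * M) ^ 2` numbers in `[0,1]`. -/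
theorem lookup {θ : (Fin m → ℝ) → ℕ} {N M B : ℕ} (hN : 1 ≤ N) (hM : 1 ≤ M)
    (hθ : ∀ x ∈ S, θ x < (N * M) ^ 2) (ξ : ℕ → ℝ) (hξ0 : ∀ n, 0 ≤ ξ n) (hξ1 : ∀ n, ξ n ≤ 1)
    (bs : List ℕ) (hbs : ∀ b ∈ bs, 1 ≤ b ∧ b ≤ B)
    (hw : Fintype.card κ * 2 + (8 * N + 2 * B + 12) ≤ w)
    (hF : Computes S w D (fun x => Sum.elim (C x) (fun _ : Unit => (θ x : ℝ)))) :
    ∃ out : (Fin m → ℝ) → ℝ,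
      Computes S w (D + (M * (2 + bs.length) + M + 3)) (fun x => Sum.elim (C x)
        (fun _ : Unit => out x)) ∧
      ∀ x ∈ S, 0 ≤ out x ∧ out x ≤ 1 ∧ |out x - ξ (θ x)| ≤ 1 / bs.prod := by
  set A := bs.prod with hAdef
  have hA : 1 ≤ A := List.one_le_prod fun c hc => (hbs c hc).1
  have hA' : (0 : ℝ) < A := by exact_mod_cast hA
  obtain ⟨V, hV, hVξ⟩ : ∃ V : ℕ → ℕ, (∀ n, V n < A) ∧
      ∀ n, (V n : ℝ) ≤ ξ n * A ∧ ξ n * A ≤ V n + 1 := by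
    -- The minimum matters only for `ξ n = 1`, where the floor would be `A` and no longer a digit.
    refine ⟨fun n => min ⌊ξ n * A⌋₊ (A - 1), fun n => ?_, fun n => ⟨?_, ?_⟩⟩
    · exact (min_le_right ⌊ξ n * A⌋₊ (A - 1)).trans_lt (by omega)
    · refine le_trans ?_ (Nat.floor_le (mul_nonneg (hξ0 n) hA'.le))
      exact_mod_cast min_le_left _ _
    · rcases min_choice ⌊ξ n * A⌋₊ (A - 1) with h | h <;> simp only [h]
      · exact (Nat.lt_floor_add_one _).le
      · push_cast [Nat.cast_sub hA]
        have := mul_le_mul_of_nonneg_right (hξ1 n) hA'.le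
        linarith
  -- The order is reversed so that entry `l` becomes the leading digit after `l` digits have been
  -- stripped from the top.
  let v : ℕ → ℕ → ℕ → ℕ → ℕ := fun p q t i => V (((p * N + q) * M + t) * M + (M - 1 - i))
  have hv : ∀ p q t i, v p q t i < A := fun p q t i => hV _
  have hMM : 1 ≤ M * M := Nat.mul_pos hM hM
  have h1 := splitDigit (n := θ) (N := N) (R := N * (M * M)) hN (Nat.mul_pos hN hMM)
    (fun x hx => (hθ x hx).trans_eq (by ring)) (by omega) hF
  have h2 := splitDigit (n := fun x => θ x % (N * (M * M))) (N := N) (R := M * M) hN hMM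
    (fun x hx => Nat.mod_lt _ (by positivity)) (by simp; omega) h1
  have hp : ∀ x ∈ S, θ x / (N * (M * M)) < N := fun x hx =>
    Nat.div_lt_of_lt_mul ((hθ x hx).trans_eq (by ring))
  have h3 := fetch (p := fun x => θ x / (N * (M * M)))
    (q := fun x => θ x % (N * (M * M)) / (M * M)) (ρ := fun x => θ x % (N * (M * M)) % (M * M))
    hM hp (fun x _ => Nat.div_lt_of_lt_mul (by rw [mul_comm]; exact Nat.mod_lt _ (by positivity)))
    (fun x _ => Nat.mod_lt _ (by positivity))
    (fun p q t => encodeDigits A (v p q t) M) (by omega) h2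
  have h4 := selectBlock (l := fun x => θ x % (N * (M * M)) % (M * M) % M) bs hbs
    (fun x _ => Nat.mod_lt _ hM) (fun x _ => encodeDigits_lt (hv _ _ _) M) (by omega) h3
  refine ⟨_, by convert h4 using 1; ring, fun x _ => ?_⟩
  simp only [← hAdef]
  set ρ := θ x % (N * (M * M)) % (M * M) with hρ
  set l := ρ % M with hl
  have hlM : l < M := Nat.mod_lt _ hM
  set u := v (θ x / (N * (M * M))) (θ x % (N * (M * M)) / (M * M)) (ρ / M) with hu
  obtain ⟨j, hj⟩ : ∃ j, M - l = j + 1 := ⟨M - l - 1, by omega⟩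
  have huθ : u j = V (θ x) := by
    simp only [hu, v]
    congr 1
    have e1 := Nat.div_add_mod (θ x) (N * (M * M))
    have e2 := Nat.div_add_mod (θ x % (N * (M * M))) (M * M)
    have e3 := Nat.div_add_mod ρ M
    rw [← hρ] at e2
    rw [show M - 1 - j = l by omega]
    set p := θ x / (N * (M * M))
    set q := θ x % (N * (M * M)) / (M * M)
    calc _ = N * (M * M) * p + (M * M * q + (M * (ρ / M) + ρ % M)) := by rw [← hl]; ring
      _ = θ x := by rw [e3, e2, e1]
  rw [encodeDigits_mod (hv _ _ _) (Nat.sub_le _ _), hj]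
  have hlt : (encodeDigits A u j : ℝ) + 1 ≤ (A : ℝ) ^ j := by
    exact_mod_cast encodeDigits_lt (hv _ _ _) j
  have hsucc : (encodeDigits A u (j + 1) : ℝ) = encodeDigits A u j + V (θ x) * (A : ℝ) ^ j := by
    rw [← huθ, encodeDigits, Finset.sum_range_succ]; push_cast [encodeDigits]; ring
  have h0 : (0 : ℝ) ≤ encodeDigits A u j := by positivity
  have hle : (encodeDigits A u (j + 1) : ℝ) ≤ (A : ℝ) ^ (j + 1) := by
    exact_mod_cast (encodeDigits_lt (hv _ _ _) (j + 1)).le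
  have hpos : (0 : ℝ) < (A : ℝ) ^ j := by positivity
  refine ⟨by positivity, (div_le_one (by positivity)).mpr hle, ?_⟩
  -- Both `ξ (θ x)` and the output lie in `[V / A, (V + 1) / A]`, hence they differ by at most `1 /
  -- A`.
  obtain ⟨g1, g2⟩ := hVξ (θ x)
  have e : (encodeDigits A u (j + 1) : ℝ) / (A : ℝ) ^ (j + 1) =
      (encodeDigits A u j / (A : ℝ) ^ j + V (θ x)) / A := by
    rw [hsucc, pow_succ]; field_simp
  have f0 : 0 ≤ (encodeDigits A u j : ℝ) / (A : ℝ) ^ j := by positivity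
  have f1 : (encodeDigits A u j : ℝ) / (A : ℝ) ^ j ≤ 1 := by
    rw [div_le_one hpos]; linarith
  have e' : ∀ z : ℝ, z / A - ξ (θ x) = (z - ξ (θ x) * A) / A := fun z => by field_simp
  rw [e, e', abs_div, abs_of_pos hA']
  gcongr
  rw [abs_le]
  constructor <;> linarith

end Computes

/-! ### Locating the cell of a point. -/

/-- The position of the coordinate `x`, in units of the cell length `2 / K`, moved slightly away
from the right end of the last cell. -/
noncomputable def cellPosition (K : ℕ) (δ x : ℝ) : ℝ :=
  min (x * K / 2) (((K + 1) / 2 : ℕ) - δ * K / 2)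

/-- The index of the cell of length `2 / K` that contains the coordinate `x`. -/
noncomputable def cellIndex (K : ℕ) (δ x : ℝ) : ℕ := ⌊cellPosition K δ x⌋₊

theorem cellIndex_spec {K : ℕ} (hK : 1 ≤ K) {δ x : ℝ} (hδ0 : 0 < δ) (hδ1 : δ ≤ 1 / (3 * (K : ℝ)))
    (hx0 : 0 ≤ x) (hx1 : x ≤ 1)
    (hx : ∀ k : ℕ, 1 ≤ k → k < K → x ∉ Set.Ioo ((k : ℝ) / K - δ) ((k : ℝ) / K)) :
    (cellIndex K δ x : ℝ) ≤ cellPosition K δ x ∧ cellIndex K δ x < (K + 1) / 2 ∧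
      cellPosition K δ x - cellIndex K δ x ≤ 1 - δ * K / 2 ∧
      |x - (2 * (cellIndex K δ x : ℝ) + 1) / K| ≤ 1 / K := by
  obtain ⟨z, hz'⟩ : ∃ z, z = cellPosition K δ x := ⟨_, rfl⟩
  have hz := hz'
  rw [cellPosition] at hz
  rw [cellIndex, ← hz']
  have hK0 : (0 : ℝ) < K := by exact_mod_cast hK
  have hδK : δ * K ≤ 1 / 3 := by
    rw [le_div_iff₀ (by positivity)] at hδ1; linarith
  have hδK0 : 0 < δ * K := by positivity
  set K' := (K + 1) / 2 with hK'
  have hK'1 : (1 : ℝ) ≤ K' := by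
    have : 1 ≤ K' := by omega
    exact_mod_cast this
  have hK'2 : (K : ℝ) ≤ 2 * K' := by
    have : K ≤ 2 * K' := by omega
    exact_mod_cast this
  have hz0 : 0 ≤ z := by rw [hz]; exact le_min (by positivity) (by linarith)
  have hzK : z ≤ K' - δ * K / 2 := by rw [hz]; exact min_le_right _ _
  have hzx : z ≤ x * K / 2 := by rw [hz]; exact min_le_left _ _
  set q := ⌊z⌋₊ with hq
  have hqz : (q : ℝ) ≤ z := Nat.floor_le hz0
  have hzq : z < q + 1 := Nat.lt_floor_add_one z
  have hqK : q < K' := by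
    have : (q : ℝ) < K' := by linarith
    exact_mod_cast this
  have hxz : z < K' - δ * K / 2 → z = x * K / 2 := by
    intro h
    rcases min_choice (x * K / 2) ((K' : ℝ) - δ * K / 2) with h' | h' <;> rw [h'] at hz <;>
      linarith
  refine ⟨hqz, hqK, ?_, ?_⟩
  · rcases (show q + 1 ≤ K' from hqK).eq_or_lt with h | h
    · have : (q : ℝ) + 1 = K' := by exact_mod_cast h
      linarith
    · have h1 : (q : ℝ) + 1 + 1 ≤ K' := by exact_mod_cast h
      have h2 := hxz (by linarith)
      -- The right end of cell `q` is the even multiple `2 * (q + 1)` of `1 / K`; odd multiples are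
      -- interior to cells and their gaps are not needed.
      have h3 := hx (2 * (q + 1)) (by omega) (by omega)
      rw [Set.mem_Ioo, not_and_or, not_lt, not_lt] at h3
      push_cast at h3
      rcases h3 with h3 | h3
      · rw [le_sub_iff_add_le, le_div_iff₀ hK0] at h3
        linarith
      · rw [div_le_iff₀ hK0] at h3
        linarith
  · have hlo : 2 * (q : ℝ) ≤ x * K := by linarith
    -- If the position was truncated, `q` is the last cell, and `x ≤ 1` with `K ≤ 2 * K'` gives the
    -- bound. For odd `K` this cell sticks out of the cube, but its centre is still `1`.
    have hhi : x * K ≤ 2 * q + 2 := by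
      by_cases h : z < K' - δ * K / 2
      · rw [hxz h] at hzq; linarith
      · have : (K' : ℝ) < q + 1 + 1 := by linarith
        have : K' < q + 1 + 1 := by exact_mod_cast this
        have : (K' : ℝ) ≤ q + 1 := by exact_mod_cast (by omega : K' ≤ q + 1)
        nlinarith
    rw [show x - (2 * (q : ℝ) + 1) / K = (x * K - (2 * q + 1)) / K by field_simp, abs_div,
      abs_of_pos hK0]
    gcongr
    rw [abs_le]
    constructor <;> linarith

/-- Stripping all integer digits of the position leaves its fractional part, and the difference of
the two is the exact cell index. The gap `δ` in `x` becomes `δ * K / 2` in units of a cell. -/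
theorem Computes.cells {d K : ℕ} {δ : ℝ} {S : Set (Fin d → ℝ)} {w B : ℕ} (hK : 1 ≤ K)
    (hδ0 : 0 < δ) (hδ1 : δ ≤ 1 / (3 * (K : ℝ))) (hS0 : ∀ x ∈ S, ∀ i, 0 ≤ x i)
    (hS1 : ∀ x ∈ S, ∀ i, x i ≤ 1)
    (hS : ∀ x ∈ S, ∀ i, ∀ k : ℕ, 1 ≤ k → k < K →
      x i ∉ Set.Ioo ((k : ℝ) / K - δ) ((k : ℝ) / K))
    (bs : List ℕ) (hbs : ∀ b ∈ bs, 1 ≤ b ∧ b ≤ B) (hprod : (K + 1) / 2 ≤ bs.prod)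
    (hw : d * (2 * B + 4) ≤ w) :
    Computes S w (1 + bs.length) (fun x => Sum.elim
      (fun i : Fin d => x i - (2 * (cellIndex K δ (x i) : ℝ) + 1) / K)
      (fun _ : Unit => ((∑ i, cellIndex K δ (x i) * ((K + 1) / 2) ^ (i : ℕ) : ℕ) : ℝ))) := by
  have hK0 : (0 : ℝ) < K := by exact_mod_cast hK
  have spec := fun x hx i => cellIndex_spec hK hδ0 hδ1 (hS0 x hx i) (hS1 x hx i) (hS x hx i)
  have h1 : Computes S w 1 (fun x => Sum.elim
      (Sum.elim (fun i : Fin d => x i) (fun i : Fin d => cellPosition K δ (x i)))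
      (fun i : Fin d => ((cellIndex K δ (x i) % (bs.prod * 1) : ℕ) : ℝ) +
        (cellPosition K δ (x i) - cellIndex K δ (x i)))) := by
    have hpos : ∀ i : Fin d, IsShallow 1 (fun x : Fin d → ℝ => cellPosition K δ (x i)) := by
      intro i
      have h := ((IsShallow.const (((K + 1) / 2 : ℕ) - δ * K / 2)).sub (IsShallow.relu
        ((IsAffine.const (((K + 1) / 2 : ℕ) - δ * K / 2)).sub
          (((IsAffine.coord i).mul_const K).div_const 2))))
      convert h using 2 with x
      rw [cellPosition]
      rcases le_total (x i * K / 2) (((K + 1) / 2 : ℕ) - δ * K / 2) with h | h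
      · rw [min_eq_left h, max_eq_right (by linarith)]; ring
      · rw [min_eq_right h, max_eq_left (by linarith)]; ring
    refine Computes.input.step (Sum.elim (Sum.elim (fun _ => 2) (fun _ => 1)) (fun _ => 1)) ?_ ?_
    · simp; nlinarith
    rintro ((i | i) | i)
    · exact ⟨_, .coord i, fun x _ => rfl⟩
    · exact ⟨_, hpos i, fun x _ => rfl⟩
    · refine ⟨_, hpos i, fun x hx => ?_⟩
      have := (spec x hx i).2.1
      simp only [Sum.elim_inr]
      rw [Nat.mod_eq_of_lt (by rw [mul_one]; exact lt_of_lt_of_le this hprod)]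
      ring
  have h2 := stripDigits (δ := δ * K / 2) (by positivity)
    (fun x hx i => sub_nonneg.mpr (spec x hx i).1)
    (fun x hx i => (spec x hx i).2.2.1) le_rfl (by simp; nlinarith) bs hbs h1
  refine h2.affine ?_
  have hq : ∀ i : Fin d, ∃ g, IsAffine g ∧ ∀ x ∈ S, (cellIndex K δ (x i) : ℝ) = g (Sum.elim
      (Sum.elim (fun i : Fin d => x i) (fun i : Fin d => cellPosition K δ (x i)))
      (fun i : Fin d => ((cellIndex K δ (x i) % 1 : ℕ) : ℝ) +
        (cellPosition K δ (x i) - cellIndex K δ (x i)))) := fun i =>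
    ⟨_, (IsAffine.coord (.inl (.inr i))).sub (.coord (.inr i)), fun x _ => by
      simp [Nat.mod_one]⟩
  choose g hg hgq using hq
  rintro (i | k)
  · refine ⟨_, (IsAffine.coord (.inl (.inl i))).sub
      ((((hg i).const_mul 2).add (.const 1)).div_const K), fun x hx => ?_⟩
    simp only [← hgq i x hx, Sum.elim_inl]
  · refine ⟨_, IsAffine.sum Finset.univ fun i _ =>
      (hg i).mul_const ((((K + 1) / 2 : ℕ) : ℝ) ^ (i : ℕ)), fun x hx => ?_⟩
    simp only [Sum.elim_inr, ← hgq _ x hx]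
    push_cast
    rfl

/-! ### Taylor's formula on the cube. -/

/-- The homogeneous part of degree `j` of a Taylor polynomial with coefficients `c`, times `j!`. -/
def taylorForm {d : ℕ} (c : (Fin d → ℕ) → ℝ) : ℕ → (Fin d → ℕ) → (Fin d → ℝ) → ℝ
  | 0, α, _ => c α
  | j + 1, α, h => ∑ i, h i * taylorForm c j (α + Pi.single i 1) h

section Taylor

variable {d : ℕ}

/-- Expanding over words instead of multi-indices avoids multinomial coefficients: each term is one
coefficient times a product along a list, the shape handled by `Computes.monomial`. -/
theorem taylorForm_eq_sum (c : (Fin d → ℕ) → ℝ) (j : ℕ) (α : Fin d → ℕ) (h : Fin d → ℝ) :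
    taylorForm c j α h = ∑ i : Fin j → Fin d,
      ((List.ofFn i).map h).prod * c (α + ∑ k, Pi.single (i k) 1) := by
  induction j generalizing α with
  | zero => simp [taylorForm]
  | succ j ih =>
    rw [← (Fin.consEquiv fun _ => Fin d).sum_comp, Fintype.sum_prod_type, taylorForm]
    refine Finset.sum_congr rfl fun i _ => ?_
    rw [ih, Finset.mul_sum]
    refine Finset.sum_congr rfl fun l _ => ?_
    simp [Fin.consEquiv, List.ofFn_succ, Fin.sum_univ_succ, mul_assoc, add_assoc]

theorem hasDerivAt_taylorForm (c : (Fin d → ℕ) → ℝ) (j : ℕ) (α : Fin d → ℕ) (h : Fin d → ℝ)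
    (i : Fin d) (t : ℝ) :
    HasDerivAt (fun t => taylorForm c j α (Function.update h i t))
      (j * taylorForm c (j - 1) (α + Pi.single i 1) (Function.update h i t)) t := by
  induction j generalizing α with
  | zero => simpa [taylorForm] using hasDerivAt_const t (c α)
  | succ j ih =>
    have hu : ∀ k, HasDerivAt (fun t => Function.update h i t k) (if k = i then 1 else 0) t := by
      intro k
      split_ifs with hk
      · subst hk; simpa using hasDerivAt_id' t
      · simpa [Function.update_of_ne hk] using hasDerivAt_const t (h k)
    have := HasDerivAt.fun_sum (u := Finset.univ) fun k _ => (hu k).mul (ih (α + Pi.single k 1))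
    simp only [taylorForm]
    refine this.congr_deriv ?_
    rw [Finset.sum_add_distrib]
    simp only [ite_mul, one_mul, zero_mul, Finset.sum_ite_eq', Finset.mem_univ, if_true]
    rcases j with _ | j
    · simp
    · have e : ∑ k, Function.update h i t k * (((j + 1 : ℕ) : ℝ) *
          taylorForm c (j + 1 - 1) (α + Pi.single k 1 + Pi.single i 1) (Function.update h i t)) =
          ((j + 1 : ℕ) : ℝ) * taylorForm c (j + 1) (α + Pi.single i 1)
            (Function.update h i t) := by
        rw [taylorForm, Finset.mul_sum]
        refine Finset.sum_congr rfl fun k _ => ?_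
        rw [add_right_comm, Nat.add_sub_cancel]; ring
      rw [e]
      push_cast [Nat.add_sub_cancel]
      ring

/-- The point moves from `y` to `x` one coordinate at a time, with the mean value inequality on each
segment. Only partial derivatives are needed, and the path stays in the cube and in the box of
radius `a` about `y`. -/
theorem abs_sub_le_of_partialDeriv {E : (Fin d → ℝ) → ℝ} {G : Fin d → (Fin d → ℝ) → ℝ}
    {x y : Fin d → ℝ} {a C : ℝ} (hx : ∀ i, x i ∈ Set.Icc (0 : ℝ) 1)
    (hy : ∀ i, y i ∈ Set.Icc (0 : ℝ) 1) (hxy : ∀ i, |x i - y i| ≤ a)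
    (hE : ∀ i u, (∀ j, u j ∈ Set.Icc (0 : ℝ) 1) →
      HasDerivWithinAt (fun t => E (Function.update u i t)) (G i u) (Set.Icc 0 1) (u i))
    (hG : ∀ i u, (∀ j, u j ∈ Set.Icc (0 : ℝ) 1) → (∀ j, |u j - y j| ≤ a) → |G i u| ≤ C)
    (hC : 0 ≤ C) : |E x - E y| ≤ d * a * C := by
  have ha : ∀ i : Fin d, 0 ≤ a := fun i => (abs_nonneg _).trans (hxy i)
  set z : ℕ → Fin d → ℝ := fun k i => if (i : ℕ) < k then x i else y i with hz
  have key : ∀ k ∈ Finset.range d, |E (z (k + 1)) - E (z k)| ≤ a * C := by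
    intro k hk
    let i : Fin d := ⟨k, Finset.mem_range.mp hk⟩
    have hz0 : z k = Function.update (z k) i (y i) := by
      funext j
      by_cases hj : j = i
      · subst hj; simp [hz, i]
      · simp [hj]
    have hz1 : z (k + 1) = Function.update (z k) i (x i) := by
      funext j
      by_cases hj : j = i
      · subst hj; simp [hz, i]
      · have : (j : ℕ) ≠ k := fun h => hj (Fin.ext h)
        simp only [hz, Function.update_of_ne hj]
        congr 1
        rw [eq_iff_iff]; omega
    have hsub : Set.uIcc (y i) (x i) ⊆ Set.Icc 0 1 := Set.uIcc_subset_Icc (hy i) (hx i)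
    have hmem : ∀ t ∈ Set.uIcc (y i) (x i), ∀ j,
        Function.update (z k) i t j ∈ Set.Icc (0 : ℝ) 1 := by
      intro t ht j
      by_cases hj : j = i
      · subst hj; simpa using hsub ht
      · simp only [Function.update_of_ne hj, hz]
        split_ifs <;> [exact hx j; exact hy j]
    have hdist : ∀ t ∈ Set.uIcc (y i) (x i), ∀ j, |Function.update (z k) i t j - y j| ≤ a := by
      intro t ht j
      by_cases hj : j = i
      · subst hj
        rw [Function.update_self]
        exact (Set.abs_sub_left_of_mem_uIcc ht).trans (hxy _)
      · simp only [Function.update_of_ne hj, hz]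
        split_ifs
        · exact hxy j
        · simpa using ha i
    have hderiv : ∀ t ∈ Set.uIcc (y i) (x i),
        HasDerivWithinAt (fun t => E (Function.update (z k) i t))
          (G i (Function.update (z k) i t)) (Set.uIcc (y i) (x i)) t := by
      intro t ht
      have := hE i _ (hmem t ht)
      simp only [Function.update_idem, Function.update_self] at this
      exact this.mono hsub
    have := (convex_uIcc (y i) (x i)).norm_image_sub_le_of_norm_hasDerivWithin_le hderiv
      (fun t ht => hG i _ (hmem t ht) (hdist t ht)) Set.left_mem_uIcc Set.right_mem_uIcc
    rw [Real.norm_eq_abs, Real.norm_eq_abs] at this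
    rw [hz1]
    nth_rewrite 2 [hz0]
    calc _ ≤ C * |x i - y i| := this
      _ ≤ C * a := by gcongr; exact hxy i
      _ = a * C := mul_comm _ _
  have hd : z d = x := by funext i; simp [hz]
  have h0 : z 0 = y := by funext i; simp [hz]
  rw [← hd, ← h0, ← Finset.sum_range_sub (fun k => E (z k))]
  calc _ ≤ ∑ k ∈ Finset.range d, |E (z (k + 1)) - E (z k)| := Finset.abs_sum_le_sum_abs _ _
    _ ≤ ∑ k ∈ Finset.range d, a * C := Finset.sum_le_sum key
    _ = d * a * C := by simp; ring

/-- Taylor's formula for a family `T` of iterated partial derivatives on the cube. -/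
theorem abs_sub_taylor_le {s : ℕ} {T : (Fin d → ℕ) → (Fin d → ℝ) → ℝ} {a H : ℝ} (ha : 0 ≤ a)
    (hH : 0 ≤ H)
    (hT : ∀ α : Fin d → ℕ, ∑ j, α j < s → ∀ i u, (∀ j, u j ∈ Set.Icc (0 : ℝ) 1) →
      HasDerivWithinAt (fun t => T α (Function.update u i t)) (T (α + Pi.single i 1) u)
        (Set.Icc 0 1) (u i))
    {y : Fin d → ℝ} (hy : ∀ i, y i ∈ Set.Icc (0 : ℝ) 1)
    (hTs : ∀ α : Fin d → ℕ, ∑ j, α j = s → ∀ x : Fin d → ℝ, (∀ i, x i ∈ Set.Icc (0 : ℝ) 1) →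
      (∀ i, |x i - y i| ≤ a) → |T α x - T α y| ≤ H)
    (n : ℕ) (α : Fin d → ℕ) (hα : ∑ j, α j + n = s) {x : Fin d → ℝ}
    (hx : ∀ i, x i ∈ Set.Icc (0 : ℝ) 1) (hxy : ∀ i, |x i - y i| ≤ a) :
    |T α x - ∑ j ∈ Finset.range (n + 1),
      taylorForm (fun α => T α y) j α (x - y) / (j.factorial : ℝ)| ≤ (d * a) ^ n * H := by
  induction n generalizing α x with
  | zero => simpa [taylorForm] using hTs α (by simpa using hα) x hx hxy
  | succ n ih =>
    set E : (Fin d → ℝ) → ℝ := fun x => T α x - ∑ j ∈ Finset.range (n + 1 + 1),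
      taylorForm (fun α => T α y) j α (x - y) / (j.factorial : ℝ) with hE
    have hEy : E y = 0 := by
      have : ∀ j ∈ Finset.range (n + 1), taylorForm (fun α => T α y) (j + 1) α (y - y) /
          ((j + 1).factorial : ℝ) = 0 := by
        intro j _; simp [taylorForm]
      simp only [hE]
      rw [Finset.sum_range_succ', Finset.sum_eq_zero this]
      simp [taylorForm]
    have hsum : ∀ i : Fin d, ∑ j, (α + Pi.single i 1 : Fin d → ℕ) j + n = s := by
      intro i
      simp only [Pi.add_apply, Finset.sum_add_distrib, Finset.sum_pi_single', Finset.mem_univ,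
        if_true]
      omega
    -- The `i`-th partial derivative of the remainder is the remainder, one order lower, of the
    -- family at `α + Pi.single i 1`. As the remainder vanishes at `y`, each order costs a factor `d
    -- * a`.
    have hderiv : ∀ i u, (∀ j, u j ∈ Set.Icc (0 : ℝ) 1) →
        HasDerivWithinAt (fun t => E (Function.update u i t))
          (T (α + Pi.single i 1) u - ∑ j ∈ Finset.range (n + 1),
            taylorForm (fun α => T α y) j (α + Pi.single i 1) (u - y) / (j.factorial : ℝ))
          (Set.Icc 0 1) (u i) := by
      intro i u hu
      refine (hT α (by omega) i u hu).sub ?_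
      have hf : ∀ j, HasDerivWithinAt (fun t => taylorForm (fun α => T α y) j α
          (Function.update u i t - y) / (j.factorial : ℝ))
          (j * taylorForm (fun α => T α y) (j - 1) (α + Pi.single i 1) (u - y) /
            (j.factorial : ℝ)) (Set.Icc 0 1) (u i) := by
        intro j
        have h1 := hasDerivAt_taylorForm (fun α => T α y) j α (u - y) i (u i - y i)
        have h2 := h1.comp_sub_const (u i) (y i)
        have e : ∀ t, Function.update (u - y) i (t - y i) = Function.update u i t - y := by
          intro t
          funext k
          by_cases hk : k = i
          · subst hk; simp
          · simp [hk]
        simp only [e, Function.update_eq_self] at h2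
        exact (h2.div_const _).hasDerivWithinAt
      have := HasDerivWithinAt.fun_sum (u := Finset.range (n + 1 + 1)) fun j _ => hf j
      refine this.congr_deriv ?_
      rw [Finset.sum_range_succ']
      simp only [Nat.cast_zero, zero_mul, zero_div, add_zero]
      refine Finset.sum_congr rfl fun j _ => ?_
      rw [Nat.add_sub_cancel, Nat.factorial_succ]
      push_cast
      have : (j : ℝ) + 1 ≠ 0 := by positivity
      have : (j.factorial : ℝ) ≠ 0 := by positivity
      field_simp
    have := abs_sub_le_of_partialDeriv hx hy hxy hderiv
      (fun i u hu hua => ih (α + Pi.single i 1) (hsum i) hu hua) (by positivity)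
    rw [hEy, sub_zero] at this
    refine this.trans_eq ?_
    ring

theorem hasDerivWithinAt_comp_sub_const {g : ℝ → ℝ} {g' a : ℝ} {s t : Set ℝ}
    (hg : HasDerivWithinAt g g' s 0) (hst : Set.MapsTo (fun y => y - a) t s) :
    HasDerivWithinAt (fun y => g (y - a)) g' t a := by
  have h := hg.comp_of_eq a ((hasDerivWithinAt_id a t).sub_const a) hst (by simp)
  simpa [Function.comp_def] using h

theorem HolderClass.abs_sub_taylor_le {s : ℕ} {r B₀ : ℝ} (hr : 0 ≤ r) (hB₀ : 0 ≤ B₀)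
    {f : EuclideanSpace ℝ (Fin d) → ℝ} (hf : HolderClass d s r B₀ f) :
    ∃ T : (Fin d → ℕ) → (Fin d → ℝ) → ℝ,
      (∀ α : Fin d → ℕ, ∑ j, α j ≤ s → ∀ x : Fin d → ℝ, (∀ i, x i ∈ Set.Icc (0 : ℝ) 1) →
        |T α x| ≤ B₀) ∧
      ∀ x y : Fin d → ℝ, (∀ i, x i ∈ Set.Icc (0 : ℝ) 1) → (∀ i, y i ∈ Set.Icc (0 : ℝ) 1) →
        ∀ a, 0 ≤ a → (∀ i, |x i - y i| ≤ a) →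
        |f (WithLp.toLp 2 x) - ∑ j ∈ Finset.range (s + 1),
          taylorForm (fun α => T α y) j 0 (x - y) / (j.factorial : ℝ)| ≤
          (d * a) ^ s * (B₀ * (√d * a) ^ r) := by
  obtain ⟨D, hD0, hD, hDb, hDs⟩ := hf
  refine ⟨fun α x => D α (WithLp.toLp 2 x), fun α hα x hx => hDb α hα _ hx,
    fun x y hx hy a ha hxy => ?_⟩
  rw [← hD0 _ hx]
  refine _root_.abs_sub_taylor_le (s := s) (T := fun α x => D α (WithLp.toLp 2 x)) ha
    (by positivity) ?_ hy ?_ s 0 (by simp) hx hxy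
  · intro α hα i u hu
    have h := hD α hα i (WithLp.toLp 2 u) hu
    rw [HasLineDerivWithinAt] at h
    have e : ∀ t : ℝ, WithLp.toLp 2 u + (t - u i) • EuclideanSpace.single i (1 : ℝ) =
        WithLp.toLp 2 (Function.update u i t) := by
      intro t
      ext k
      by_cases hk : k = i
      · subst hk; simp
      · simp [hk]
    have h2 := hasDerivWithinAt_comp_sub_const (a := u i) (t := Set.Icc 0 1) h ?_
    · simpa only [e] using h2
    · intro t ht k
      change (WithLp.toLp 2 u + (t - u i) • EuclideanSpace.single i (1 : ℝ)) k ∈ _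
      rw [e]
      by_cases hk : k = i
      · subst hk; simpa using ht
      · simpa [hk] using hu k
  · intro α hα x hx hxa
    refine (hDs α hα _ hx _ hy).trans ?_
    gcongr
    rw [EuclideanSpace.norm_eq, ← Real.sqrt_sq ha, ← Real.sqrt_mul (by positivity)]
    refine Real.sqrt_le_sqrt ?_
    calc _ ≤ ∑ _i : Fin d, a ^ 2 := by
          refine Finset.sum_le_sum fun i _ => ?_
          exact pow_le_pow_left₀ (norm_nonneg _) (hxa i) 2
      _ = d * a ^ 2 := by simp

end Taylor

/-! ### Assembling the network and counting. -/

/-- Bases of a positional system with `(N * 2 ^ ⌈log₂ M⌉) ^ k` values, using digits in base `N` and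
binary digits. -/
def digitBases (N M k : ℕ) : List ℕ :=
  List.replicate k N ++ List.replicate (k * Nat.clog 2 M) 2

theorem digitBases_prod (N M k : ℕ) : (digitBases N M k).prod = (N * 2 ^ Nat.clog 2 M) ^ k := by
  simp [digitBases, mul_pow, ← pow_mul, mul_comm]

theorem le_digitBases_prod (N M k : ℕ) : (N * M) ^ k ≤ (digitBases N M k).prod := by
  rw [digitBases_prod]
  exact Nat.pow_le_pow_left (Nat.mul_le_mul_left _ (Nat.le_pow_clog one_lt_two M)) k

theorem digitBases_length (N M k : ℕ) :
    (digitBases N M k).length = k * (1 + Nat.clog 2 M) := by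
  simp [digitBases]; ring

theorem mem_digitBases {N M k : ℕ} (hN : 1 ≤ N) : ∀ b ∈ digitBases N M k, 1 ≤ b ∧ b ≤ 2 * N := by
  intro b hb
  rw [digitBases, List.mem_append, List.mem_replicate, List.mem_replicate] at hb
  omega

/-- The centre of the cell containing `x`. -/
noncomputable def cellCenter {d : ℕ} (K : ℕ) (δ : ℝ) (x : Fin d → ℝ) : Fin d → ℝ :=
  fun i => (2 * (cellIndex K δ (x i) : ℝ) + 1) / K

/-- With `a = s + 1` and `p = 1 + Nat.clog 2 M`, the summands are the depths for locating the cell,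
looking up a coefficient, and at most `s` products. -/
theorem depth_bound {M p a : ℕ} (hM : 1 ≤ M) (hp : 1 ≤ p) (ha : 1 ≤ a) :
    1 + 2 * p + (M * (2 + 2 * a * p) + M + 3) + a * (a * p) ≤ 21 * a ^ 2 * M * p := by
  have h1 : 1 ≤ a ^ 2 := Nat.one_le_pow _ _ ha
  have h2 : a ≤ a ^ 2 := by nlinarith
  have hMp : 1 ≤ M * p := Nat.mul_pos hM hp
  have e1 : 1 * (M * p) ≤ a ^ 2 * (M * p) := Nat.mul_le_mul_right _ h1
  have e2 : a * (M * p) ≤ a ^ 2 * (M * p) := Nat.mul_le_mul_right _ h2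
  have e3 : a ^ 2 * (1 * p) ≤ a ^ 2 * (M * p) :=
    Nat.mul_le_mul_left _ (Nat.mul_le_mul_right _ hM)
  have e4 : M * 1 ≤ M * p := Nat.mul_le_mul_left _ hp
  have e5 : 1 * p ≤ M * p := Nat.mul_le_mul_right _ hM
  nlinarith

theorem Computes.taylorTerm {d K N M s : ℕ} {δ : ℝ} {S : Set (Fin d → ℝ)} {w : ℕ} (hd : 1 ≤ d)
    (hK : 2 ≤ K) (hN : 1 ≤ N) (hM : 1 ≤ M) (hNM : 2 ≤ N * M)
    (hKNM : ((K + 1) / 2) ^ d ≤ (N * M) ^ 2) (hδ0 : 0 < δ) (hδ1 : δ ≤ 1 / (3 * (K : ℝ)))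
    (hS0 : ∀ x ∈ S, ∀ i, 0 ≤ x i) (hS1 : ∀ x ∈ S, ∀ i, x i ≤ 1)
    (hS : ∀ x ∈ S, ∀ i, ∀ k : ℕ, 1 ≤ k → k < K →
      x i ∉ Set.Ioo ((k : ℝ) / K - δ) ((k : ℝ) / K))
    (hw : 38 * d * N ≤ w) {V : (Fin d → ℝ) → ℝ}
    (hV : ∀ y : Fin d → ℝ, (∀ i, y i ∈ Set.Icc (0 : ℝ) 1) → |V y| ≤ 1) (l : List (Fin d))
    (hl : l.length ≤ s) :
    ∃ c : (Fin d → ℝ) → ℝ,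
      Computes S w (21 * (s + 1) ^ 2 * M * (1 + Nat.clog 2 M)) (fun x (_ : Unit) => c x) ∧
      ∀ x ∈ S, |c x - V (cellCenter K δ x) * (l.map (x - cellCenter K δ x)).prod| ≤
        ((l.length : ℝ) + 2) / ((N : ℝ) * M) ^ (2 * (s + 1)) := by
  have hK0 : (0 : ℝ) < K := by exact_mod_cast (by omega : 0 < K)
  have hdN : 1 ≤ d * N := Nat.mul_pos hd hN
  have hdN1 : N ≤ d * N := Nat.le_mul_of_pos_left _ hd
  have hdN2 : d ≤ d * N := Nat.le_mul_of_pos_right _ hN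
  have hw' : 38 * (d * N) ≤ w := by rw [← mul_assoc]; exact hw
  set K' := (K + 1) / 2 with hK'
  have spec := fun x hx i => cellIndex_spec (by omega) hδ0 hδ1 (hS0 x hx i) (hS1 x hx i)
    (hS x hx i)
  have hcell := Computes.cells (w := w) (B := 2 * N) (by omega) hδ0 hδ1 hS0 hS1 hS
    (digitBases N M 2) (mem_digitBases hN)
    ((Nat.le_self_pow (by omega) _).trans (hKNM.trans (le_digitBases_prod N M 2)))
    (by nlinarith)
  -- The table lists `V` at the cell centres, rescaled from `[-1, 1]` to `[0, 1]` as `lookup`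
  -- requires; entries beyond the number of cells are irrelevant.
  let ξ : ℕ → ℝ := fun n => if h : n < K' ^ d then
    (V (fun i => (2 * ((finFunctionFinEquiv.symm ⟨n, h⟩ i : ℕ) : ℝ) + 1) / K) + 1) / 2 else 0
  have hcube : ∀ q : Fin d → Fin K', ∀ i,
      (2 * ((q i : ℕ) : ℝ) + 1) / K ∈ Set.Icc (0 : ℝ) 1 := by
    intro q i
    refine ⟨by positivity, ?_⟩
    rw [div_le_one hK0]
    have := (q i).2
    exact_mod_cast (by omega : 2 * (q i : ℕ) + 1 ≤ K)
  have hξ : ∀ n, 0 ≤ ξ n ∧ ξ n ≤ 1 := by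
    intro n
    simp only [ξ]
    split_ifs with h
    · have := abs_le.mp (hV _ (hcube (finFunctionFinEquiv.symm ⟨n, h⟩)))
      constructor <;> linarith
    · norm_num
  have hq : ∀ x ∈ S, ∃ q : Fin d → Fin K', (∀ i, cellIndex K δ (x i) = q i) ∧
      ∑ i, cellIndex K δ (x i) * K' ^ (i : ℕ) = finFunctionFinEquiv q := fun x hx =>
    ⟨fun i => ⟨_, (spec x hx i).2.1⟩, fun i => rfl, by simp⟩
  have hξθ : ∀ x ∈ S, ξ (∑ i, cellIndex K δ (x i) * K' ^ (i : ℕ)) =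
      (V (cellCenter K δ x) + 1) / 2 := by
    intro x hx
    obtain ⟨q, hq1, hq2⟩ := hq x hx
    rw [hq2]
    simp only [ξ, Fin.is_lt, dif_pos, Fin.eta, Equiv.symm_apply_apply]
    congr 3
    funext i
    rw [cellCenter, hq1]
  have hθ : ∀ x ∈ S, ∑ i, cellIndex K δ (x i) * K' ^ (i : ℕ) < (N * M) ^ 2 := by
    intro x hx
    obtain ⟨q, -, hq2⟩ := hq x hx
    rw [hq2]
    exact (Fin.is_lt _).trans_le hKNM
  obtain ⟨out, hout, hout'⟩ := hcell.lookup hN hM hθ ξ (fun n => (hξ n).1) (fun n => (hξ n).2)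
    (digitBases N M (2 * (s + 1))) (mem_digitBases hN) (by simp; omega)
  have hc := hout.affine (F' := fun x => Sum.elim
      (fun i : Fin d => x i - (2 * (cellIndex K δ (x i) : ℝ) + 1) / K)
      (fun _ : Unit => 2 * out x - 1)) (by
    rintro (i | k)
    · exact ⟨_, .coord (.inl i), fun x _ => rfl⟩
    · exact ⟨_, ((IsAffine.coord (.inr ())).const_mul 2).sub (.const 1), fun x _ => rfl⟩)
  have hNM' : (2 : ℝ) ≤ (N : ℝ) * M := by exact_mod_cast hNM
  have hprod : ∀ k, ((N : ℝ) * M) ^ k ≤ (digitBases N M k).prod := fun k => by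
    exact_mod_cast le_digitBases_prod N M k
  obtain ⟨c, hc1, hc2⟩ := hc.monomial (B := 2 * N) (by simp; omega) (digitBases N M (s + 1))
    (mem_digitBases hN)
    (le_trans (hNM.trans (Nat.le_self_pow (by omega) _)) (le_digitBases_prod N M (s + 1)))
    (fun x hx i => ((spec x hx i).2.2.2).trans (by
      apply one_div_le_one_div_of_le <;> norm_num; exact_mod_cast hK))
    (fun x hx => by
      have := hout' x hx
      rw [abs_le]; constructor <;> linarith) l
  refine ⟨c, ?_, fun x hx => ?_⟩
  · have h1 : Computes S w _ (fun x (_ : Unit) => c x) :=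
      hc1.affine fun _ => ⟨_, .coord (.inr ()), fun x _ => rfl⟩
    rw [digitBases_length, digitBases_length, digitBases_length] at h1
    have hle : 1 + 2 * (1 + Nat.clog 2 M) +
        (M * (2 + 2 * (s + 1) * (1 + Nat.clog 2 M)) + M + 3) +
        l.length * ((s + 1) * (1 + Nat.clog 2 M)) ≤
        21 * (s + 1) ^ 2 * M * (1 + Nat.clog 2 M) := by
      refine le_trans ?_ (depth_bound hM (p := 1 + Nat.clog 2 M) (a := s + 1) (by omega)
        (by omega))
      gcongr
      omega
    obtain ⟨k, hk⟩ := Nat.exists_eq_add_of_le hle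
    rw [hk]
    exact h1.pad (by simp; omega) k
  · have h1 := hc2 x hx
    obtain ⟨-, -, h2⟩ := hout' x hx
    rw [hξθ x hx] at h2
    have hP : |(l.map (x - cellCenter K δ x)).prod| ≤ 1 :=
      List.abs_prod_map_le_one (fun i => ((spec x hx i).2.2.2).trans (by
        rw [div_le_one hK0]; exact_mod_cast (by omega : 1 ≤ K))) l
    change |c x - (2 * out x - 1) * (l.map (x - cellCenter K δ x)).prod| ≤ _ at h1
    have e : c x - V (cellCenter K δ x) * (l.map (x - cellCenter K δ x)).prod =
        (c x - (2 * out x - 1) * (l.map (x - cellCenter K δ x)).prod) +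
        2 * (out x - (V (cellCenter K δ x) + 1) / 2) * (l.map (x - cellCenter K δ x)).prod := by
      ring
    rw [e]
    refine (abs_add_le _ _).trans ?_
    -- One unit of error comes from each product, since precision `(N * M) ^ (s + 1)` enters
    -- squared. The lookup contributes `2`, because undoing the rescaling doubles its error.
    rw [add_div (l.length : ℝ) 2]
    refine add_le_add (h1.trans ?_) ?_
    · rw [mul_comm 2, pow_mul]
      gcongr
      exact hprod _
    · rw [abs_mul, abs_mul, abs_two]
      refine (mul_le_of_le_one_right (by positivity) hP).trans ?_
      rw [div_eq_mul_one_div (2 : ℝ) (((N : ℝ) * M) ^ _)]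
      gcongr
      exact h2.trans (one_div_le_one_div_of_le (by positivity) (hprod _))

/-- There are at most `(s + 1) * d ^ s` words, each with a parallel subnetwork of width `38 * d *
N`. The constant `3` comes from `j + 2 ≤ 3 * j!`, so the Taylor denominators absorb the error of
long products. -/
theorem Computes.taylorSum {d K N M s : ℕ} {δ : ℝ} {S : Set (Fin d → ℝ)} (hd : 1 ≤ d)
    (hK : 2 ≤ K) (hN : 1 ≤ N) (hM : 1 ≤ M) (hNM : 2 ≤ N * M)
    (hKNM : ((K + 1) / 2) ^ d ≤ (N * M) ^ 2) (hδ0 : 0 < δ) (hδ1 : δ ≤ 1 / (3 * (K : ℝ)))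
    (hS0 : ∀ x ∈ S, ∀ i, 0 ≤ x i) (hS1 : ∀ x ∈ S, ∀ i, x i ≤ 1)
    (hS : ∀ x ∈ S, ∀ i, ∀ k : ℕ, 1 ≤ k → k < K →
      x i ∉ Set.Ioo ((k : ℝ) / K - δ) ((k : ℝ) / K))
    {B₀ : ℝ} (hB₀ : 0 < B₀) {T : (Fin d → ℕ) → (Fin d → ℝ) → ℝ}
    (hT : ∀ α : Fin d → ℕ, ∑ j, α j ≤ s → ∀ x : Fin d → ℝ, (∀ i, x i ∈ Set.Icc (0 : ℝ) 1) →
        |T α x| ≤ B₀) :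
    ∃ c : (Fin d → ℝ) → ℝ,
      Computes S (38 * (s + 1) * d ^ (s + 1) * N)
        (21 * (s + 1) ^ 2 * M * (1 + Nat.clog 2 M)) (fun x (_ : Unit) => c x) ∧
      ∀ x ∈ S, |c x - ∑ j ∈ Finset.range (s + 1),
          taylorForm (fun α => T α (cellCenter K δ x)) j 0 (x - cellCenter K δ x) /
            (j.factorial : ℝ)| ≤
        B₀ * (3 * (s + 1) * d ^ s / ((N : ℝ) * M) ^ (2 * (s + 1))) := by
  have hterm : ∀ τ : Σ j : Fin (s + 1), (Fin j → Fin d), ∃ c : (Fin d → ℝ) → ℝ,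
      Computes S (38 * d * N) (21 * (s + 1) ^ 2 * M * (1 + Nat.clog 2 M))
        (fun x (_ : Unit) => c x) ∧
      ∀ x ∈ S, |c x - T (0 + ∑ k, Pi.single (τ.2 k) 1) (cellCenter K δ x) / B₀ *
          ((List.ofFn τ.2).map (x - cellCenter K δ x)).prod| ≤
        (((List.ofFn τ.2).length : ℝ) + 2) / ((N : ℝ) * M) ^ (2 * (s + 1)) := by
    rintro ⟨j, i⟩
    have hV : ∀ y : Fin d → ℝ, (∀ i, y i ∈ Set.Icc (0 : ℝ) 1) →
        |T (0 + ∑ k, Pi.single (i k) 1) y / B₀| ≤ 1 := by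
      intro y hy
      rw [abs_div, abs_of_pos hB₀, div_le_one hB₀]
      refine hT _ ?_ y hy
      simp only [zero_add, Finset.sum_apply]
      rw [Finset.sum_comm]
      simp only [Finset.sum_pi_single', Finset.mem_univ, if_true, Finset.sum_const,
        Finset.card_univ, Fintype.card_fin, smul_eq_mul, mul_one]
      omega
    obtain ⟨c, h1, h2⟩ := Computes.taylorTerm (s := s) hd hK hN hM hNM hKNM hδ0 hδ1 hS0 hS1 hS
      (le_refl (38 * d * N)) hV (List.ofFn i) (by rw [List.length_ofFn]; omega)
    exact ⟨c, h1, h2⟩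
  choose c hc hc' using hterm
  have hcard : (Finset.univ : Finset (Σ j : Fin (s + 1), (Fin j → Fin d))).card ≤
      (s + 1) * d ^ s := by
    rw [Finset.card_univ, Fintype.card_sigma]
    refine (Finset.sum_le_card_nsmul _ _ (d ^ s) fun j _ => ?_).trans (by simp)
    simp only [Fintype.card_fun, Fintype.card_fin]
    exact Nat.pow_le_pow_right hd (by omega)
  refine ⟨fun x => ∑ τ : Σ j : Fin (s + 1), (Fin j → Fin d),
    B₀ / ((τ.1 : ℕ).factorial : ℝ) * c τ x, ?_, fun x hx => ?_⟩
  · refine (Computes.sum Finset.univ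
      (f := fun (τ : Σ j : Fin (s + 1), (Fin j → Fin d)) x =>
        B₀ / ((τ.1 : ℕ).factorial : ℝ) * c τ x)
      fun τ _ => (hc τ).affine fun _ => ⟨_, (IsAffine.coord ()).const_mul _, fun x _ => rfl⟩).mono ?_
    calc _ ≤ (s + 1) * d ^ s * (38 * d * N) := Nat.mul_le_mul_right _ hcard
      _ = _ := by ring
  · have e : ∑ j ∈ Finset.range (s + 1),
          taylorForm (fun α => T α (cellCenter K δ x)) j 0 (x - cellCenter K δ x) /
            (j.factorial : ℝ) = ∑ τ : Σ j : Fin (s + 1), (Fin j → Fin d),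
          B₀ / ((τ.1 : ℕ).factorial : ℝ) *
            (T (0 + ∑ k, Pi.single (τ.2 k) 1) (cellCenter K δ x) / B₀ *
          ((List.ofFn τ.2).map (x - cellCenter K δ x)).prod) := by
      rw [Finset.sum_range, Fintype.sum_sigma]
      refine Finset.sum_congr rfl fun j _ => ?_
      rw [taylorForm_eq_sum, Finset.sum_div]
      refine Finset.sum_congr rfl fun i _ => ?_
      field_simp
    rw [e, ← Finset.sum_sub_distrib]
    refine (Finset.abs_sum_le_sum_abs _ _).trans ?_
    set Q := ((N : ℝ) * M) ^ (2 * (s + 1)) with hQ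
    have hQ0 : 0 < Q := by
      have : (0 : ℝ) < (N : ℝ) * M := by exact_mod_cast (by omega : 0 < N * M)
      positivity
    have hb : ∀ τ : Σ j : Fin (s + 1), (Fin j → Fin d),
        |B₀ / ((τ.1 : ℕ).factorial : ℝ) * c τ x - B₀ / ((τ.1 : ℕ).factorial : ℝ) *
            (T (0 + ∑ k, Pi.single (τ.2 k) 1) (cellCenter K δ x) / B₀ *
          ((List.ofFn τ.2).map (x - cellCenter K δ x)).prod)| ≤ B₀ * (3 / Q) := by
      intro τ
      have hf : (0 : ℝ) < ((τ.1 : ℕ).factorial : ℝ) := by positivity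
      have h3 : (((τ.1 : ℕ) : ℝ) + 2) ≤ 3 * ((τ.1 : ℕ).factorial : ℝ) := by
        have h1 := Nat.self_le_factorial (τ.1 : ℕ)
        have h2 := Nat.factorial_pos (τ.1 : ℕ)
        exact_mod_cast (by omega : (τ.1 : ℕ) + 2 ≤ 3 * (τ.1 : ℕ).factorial)
      rw [← mul_sub, abs_mul, abs_of_pos (by positivity)]
      have h := hc' τ x hx
      rw [List.length_ofFn] at h
      calc _ ≤ B₀ / ((τ.1 : ℕ).factorial : ℝ) * ((((τ.1 : ℕ) : ℝ) + 2) / Q) := by gcongr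
        _ ≤ B₀ / ((τ.1 : ℕ).factorial : ℝ) * (3 * ((τ.1 : ℕ).factorial : ℝ) / Q) := by gcongr
        _ = B₀ * (3 / Q) := by field_simp
    refine (Finset.sum_le_card_nsmul _ _ _ fun τ _ => hb τ).trans ?_
    rw [nsmul_eq_mul]
    have : ((Finset.univ : Finset (Σ j : Fin (s + 1), (Fin j → Fin d))).card : ℝ) ≤
        (s + 1) * (d : ℝ) ^ s := by exact_mod_cast hcard
    calc _ ≤ (s + 1) * (d : ℝ) ^ s * (B₀ * (3 / Q)) := by gcongr
      _ = _ := by ring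

/-- Rounding up in `K` is harmless after halving: `(K + 1) / 2` is `1` for `K ≤ 2` and at most `K -
1` otherwise, so it never exceeds `(M * N) ^ (2 / d)`. -/
theorem card_cells_le {d N M K : ℕ} (hd : 1 ≤ d) (hN : 1 ≤ N) (hM : 1 ≤ M)
    (hK : K = ⌈((M : ℝ) * N) ^ ((2 : ℝ) / d)⌉₊) : ((K + 1) / 2) ^ d ≤ (N * M) ^ 2 := by
  have hd0 : (0 : ℝ) < d := by exact_mod_cast hd
  have hMN : (1 : ℝ) ≤ (M : ℝ) * N := by exact_mod_cast Nat.mul_pos hM hN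
  set L := ((M : ℝ) * N) ^ ((2 : ℝ) / d) with hL
  have hL1 : 1 ≤ L := Real.one_le_rpow hMN (by positivity)
  have hKL : (K : ℝ) < L + 1 := by rw [hK]; exact Nat.ceil_lt_add_one (by linarith)
  have h : (((K + 1) / 2 : ℕ) : ℝ) ≤ L := by
    rcases le_or_gt K 2 with h | h
    · have : (((K + 1) / 2 : ℕ) : ℝ) ≤ 1 := by exact_mod_cast (by omega : (K + 1) / 2 ≤ 1)
      linarith
    · have : (((K + 1) / 2 : ℕ) : ℝ) + 1 ≤ K := by
        exact_mod_cast (by omega : (K + 1) / 2 + 1 ≤ K)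
      linarith
  have hLd : L ^ d = ((N : ℝ) * M) ^ 2 := by
    rw [hL, ← Real.rpow_natCast, ← Real.rpow_mul (by linarith), div_mul_cancel₀ _ hd0.ne',
      Real.rpow_two, mul_comm (M : ℝ)]
  have := pow_le_pow_left₀ (by positivity) h d
  rw [hLd] at this
  exact_mod_cast this

theorem HolderClass.abs_le {d s : ℕ} {r B₀ : ℝ} {f : EuclideanSpace ℝ (Fin d) → ℝ}
    (hf : HolderClass d s r B₀ f) {x : EuclideanSpace ℝ (Fin d)} (hx : x ∈ unitCube d) :
    |f x| ≤ B₀ := by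
  obtain ⟨D, hD0, -, hDb, -⟩ := hf
  rw [← hD0 x hx]
  exact hDb 0 (by simp) x hx

theorem one_add_clog_le_ceil_logb {M : ℕ} (hM : 1 ≤ M) :
    1 + Nat.clog 2 M ≤ ⌈Real.logb 2 (8 * (M : ℝ))⌉₊ := by
  have h : ⌈Real.logb 2 (8 * (M : ℝ))⌉₊ = Nat.clog 2 (8 * M) := by
    have := Real.natCeil_logb_natCast 2 (8 * M)
    push_cast at this
    exact this
  rw [h]
  have h1 : Nat.clog 2 (2 * M) = Nat.clog 2 M + 1 := by
    rw [Nat.clog_of_two_le (by norm_num) (by omega)]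
    congr 2
    omega
  have h2 := Nat.clog_mono_right 2 (by omega : 2 * M ≤ 8 * M)
  omega

/-- The Taylor remainder equals `B₀ * d ^ (s + r / 2) * (1 / κ) ^ β`, and `r ≤ 1 ≤ max β 1`. The
network error is comparable because `β / d ≤ s + 1`. The constants combine through `1 + 3 * (s + 1)
≤ 18 * (s + 1) ^ 2`. -/
theorem remainder_le {d s : ℕ} {r β B₀ X κ : ℝ} (hd : 1 ≤ d) (hr0 : 0 < r) (hr1 : r ≤ 1)
    (hβ : β = s + r) (hB₀ : 0 < B₀) (hX : 1 ≤ X) (hκ : X ^ ((2 : ℝ) / d) ≤ κ) :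
    (d * (1 / κ)) ^ s * (B₀ * (√d * (1 / κ)) ^ r) +
      B₀ * (3 * (s + 1) * d ^ s / X ^ (2 * (s + 1))) ≤
    18 * B₀ * ((s : ℝ) + 1) ^ 2 * (d : ℝ) ^ ((s : ℝ) + max β 1 / 2) * X ^ (-2 * β / d) := by
  have hd1 : (1 : ℝ) ≤ d := by exact_mod_cast hd
  have hd0 : (0 : ℝ) < d := by linarith
  have hX0 : 0 < X := by linarith
  have hL0 : 0 < X ^ ((2 : ℝ) / d) := by positivity
  have hκ0 : 0 < κ := hL0.trans_le hκ
  have hs0 : (0 : ℝ) ≤ s := by positivity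
  set Z := X ^ (-2 * β / d) with hZ
  have hZ0 : 0 < Z := by positivity
  set W := (d : ℝ) ^ ((s : ℝ) + max β 1 / 2) with hW
  have hW0 : 0 < W := by positivity
  have hκβ : (1 / κ) ^ β ≤ Z := by
    have hβ0 : 0 ≤ β := by rw [hβ]; linarith
    calc (1 / κ) ^ β ≤ (1 / X ^ ((2 : ℝ) / d)) ^ β := by gcongr
      _ = Z := by
        rw [one_div, ← Real.rpow_neg hX0.le, ← Real.rpow_mul hX0.le, hZ]
        congr 1; ring
  have h1 : (d * (1 / κ)) ^ s * (B₀ * (√d * (1 / κ)) ^ r) ≤ B₀ * (W * Z) := by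
    have e : (d * (1 / κ)) ^ s * (B₀ * (√d * (1 / κ)) ^ r) =
        B₀ * ((d : ℝ) ^ ((s : ℝ) + r / 2) * (1 / κ) ^ β) := by
      rw [hβ, Real.rpow_add hd0, Real.rpow_add (by positivity), Real.rpow_natCast,
        Real.rpow_natCast, mul_pow, Real.mul_rpow (by positivity) (by positivity),
        Real.sqrt_eq_rpow, ← Real.rpow_mul hd0.le, show (1 : ℝ) / 2 * r = r / 2 by ring]
      ring
    rw [e]
    gcongr
    · rw [hW]
      refine Real.rpow_le_rpow_of_exponent_le hd1 ?_
      have := le_max_right β 1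
      linarith
  have h2 : (d : ℝ) ^ s ≤ W := by
    rw [hW, ← Real.rpow_natCast]
    refine Real.rpow_le_rpow_of_exponent_le hd1 ?_
    have := le_max_right β 1
    linarith
  have h3 : 1 / X ^ (2 * (s + 1)) ≤ Z := by
    rw [one_div, ← Real.rpow_natCast, ← Real.rpow_neg hX0.le, hZ]
    refine Real.rpow_le_rpow_of_exponent_le hX ?_
    have hβd : β / d ≤ s + 1 := by
      rw [div_le_iff₀ hd0, hβ]
      nlinarith
    push_cast
    rw [show -2 * β / d = -2 * (β / d) by ring]
    linarith
  have h4 : B₀ * (3 * (s + 1) * d ^ s / X ^ (2 * (s + 1))) ≤ 3 * (s + 1) * (B₀ * (W * Z)) := by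
    calc _ = 3 * (s + 1) * (B₀ * (d ^ s * (1 / X ^ (2 * (s + 1))))) := by ring
      _ ≤ _ := by gcongr
  calc _ ≤ B₀ * (W * Z) + 3 * (s + 1) * (B₀ * (W * Z)) := add_le_add h1 h4
    _ = (1 + 3 * (s + 1)) * (B₀ * (W * Z)) := by ring
    _ ≤ 18 * (s + 1) ^ 2 * (B₀ * (W * Z)) := by
      gcongr
      nlinarith
    _ = _ := by ring

theorem theorem3p1 (d : ℕ) (hd : 1 ≤ d) (β : ℝ) (s : ℕ) (r : ℝ) (hr0 : 0 < r) (hr1 : r ≤ 1)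
    (hβ : β = s + r) (B₀ : ℝ) (hB₀ : 0 < B₀)
    (f : EuclideanSpace ℝ (Fin d) → ℝ) (hf : HolderClass d s r B₀ f)
    (N M : ℕ) (hN : 1 ≤ N) (hM : 1 ≤ M)
    (K : ℕ) (hK : K = ⌈((M : ℝ) * N) ^ ((2 : ℝ) / d)⌉₊)
    (δ : ℝ) (hδ0 : 0 < δ) (hδ1 : δ ≤ 1 / (3 * (K : ℝ))) :
    ∃ φ : ReLUNet d 1,
      φ.width = 38 * (s + 1) ^ 2 * d ^ (s + 1) * N * ⌈Real.logb 2 (8 * (N : ℝ))⌉₊ ∧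
      φ.depth = 21 * (s + 1) ^ 2 * M * ⌈Real.logb 2 (8 * (M : ℝ))⌉₊ ∧
      ∀ x ∈ unitCube d \ triflingRegion d K δ,
        |f x - φ.eval (fun i => x i) 0| ≤
          18 * B₀ * ((s : ℝ) + 1) ^ 2 * (d : ℝ) ^ ((s : ℝ) + max β 1 / 2) *
            ((N : ℝ) * M) ^ (-2 * β / d) := by
  have hlogN := one_add_clog_le_ceil_logb hN
  have hlogM := one_add_clog_le_ceil_logb hM
  set lN := ⌈Real.logb 2 (8 * (N : ℝ))⌉₊
  set lM := ⌈Real.logb 2 (8 * (M : ℝ))⌉₊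
  have hd1 : (1 : ℝ) ≤ d := by exact_mod_cast hd
  have hd0 : (0 : ℝ) < d := by linarith
  have hD : 21 * (s + 1) ^ 2 * M * lM ≠ 0 := by
    have : lM ≠ 0 := by omega
    positivity
  set W := 38 * (s + 1) ^ 2 * d ^ (s + 1) * N * lN with hW
  let S : Set (Fin d → ℝ) := {x | WithLp.toLp 2 x ∈ unitCube d \ triflingRegion d K δ}
  suffices ∃ c : (Fin d → ℝ) → ℝ,
      Computes S W (21 * (s + 1) ^ 2 * M * lM) (fun x (_ : Unit) => c x) ∧
      ∀ x ∈ S, |f (WithLp.toLp 2 x) - c x| ≤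
        18 * B₀ * ((s : ℝ) + 1) ^ 2 * (d : ℝ) ^ ((s : ℝ) + max β 1 / 2) *
            ((N : ℝ) * M) ^ (-2 * β / d) by
    obtain ⟨c, hc, hc'⟩ := this
    obtain ⟨φ, hφ1, hφ2, hφ⟩ := Computes.exists_net (F := fun x (_ : Fin 1) => c x)
      (hc.coordwise fun _ => .inl ⟨(), fun _ _ => rfl⟩) hD
    refine ⟨φ, hφ1, hφ2, fun x hx => ?_⟩
    have hxS : (fun i => x i) ∈ S := hx
    rw [hφ _ hxS]
    exact hc' _ hxS
  have hNM1 : 1 ≤ N * M := Nat.mul_pos hN hM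
  rcases hNM1.eq_or_lt with hNM | hNM
  -- For `N * M = 1` the claimed error is at least `B₀`, so the zero function suffices. Otherwise `K
  -- ≥ 2`, which makes the increments at most `1 / 2`.
  · refine ⟨fun _ => 0, Computes.zero, fun x hx => ?_⟩
    have hNM' : (N : ℝ) * M = 1 := by exact_mod_cast hNM.symm
    rw [hNM', Real.one_rpow, sub_zero, mul_one]
    refine (hf.abs_le hx.1).trans ?_
    have h1 : (1 : ℝ) ≤ (d : ℝ) ^ ((s : ℝ) + max β 1 / 2) :=
      Real.one_le_rpow hd1 (by positivity)
    have h2 : (1 : ℝ) ≤ ((s : ℝ) + 1) ^ 2 := one_le_pow₀ (by linarith [Nat.cast_nonneg (α := ℝ) s])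
    have h3 := one_le_mul_of_one_le_of_one_le h2 h1
    nlinarith
  have hNM' : (1 : ℝ) < (N : ℝ) * M := by exact_mod_cast hNM
  have hL1 : 1 < ((M : ℝ) * N) ^ ((2 : ℝ) / d) :=
    Real.one_lt_rpow (by rwa [mul_comm]) (by positivity)
  have hKL : ((M : ℝ) * N) ^ ((2 : ℝ) / d) ≤ K := by rw [hK]; exact Nat.le_ceil _
  have hK2 : 2 ≤ K := by
    have : (1 : ℝ) < K := by linarith
    exact_mod_cast this
  have hK0 : (0 : ℝ) < K := by linarith
  obtain ⟨T, hT, hfT⟩ := hf.abs_sub_taylor_le hr0.le hB₀.le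
  have hS0 : ∀ x ∈ S, ∀ i, 0 ≤ x i := fun x hx i => (hx.1 i).1
  have hS1 : ∀ x ∈ S, ∀ i, x i ≤ 1 := fun x hx i => (hx.1 i).2
  have hS : ∀ x ∈ S, ∀ i, ∀ k : ℕ, 1 ≤ k → k < K →
      x i ∉ Set.Ioo ((k : ℝ) / K - δ) ((k : ℝ) / K) :=
    fun x hx i k h1 h2 h3 => hx.2 ⟨i, k, h1, h2, h3⟩
  obtain ⟨c, hc, hc'⟩ := Computes.taylorSum (s := s) hd hK2 hN hM hNM
    (card_cells_le hd hN hM hK) hδ0 hδ1 hS0 hS1 hS hB₀ hT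
  refine ⟨c, ?_, fun x hx => ?_⟩
  -- The construction is narrower and possibly shallower than prescribed; zero neurons and identity
  -- layers make up the exact sizes.
  · have h1 : 38 * (s + 1) * d ^ (s + 1) * N ≤ W := by
      calc 38 * (s + 1) * d ^ (s + 1) * N = 38 * (s + 1) * d ^ (s + 1) * N * 1 := by ring
        _ ≤ 38 * (s + 1) ^ 2 * d ^ (s + 1) * N * lN := by
          gcongr
          · exact Nat.le_self_pow (by norm_num) _
          · omega
    have h2 : 21 * (s + 1) ^ 2 * M * (1 + Nat.clog 2 M) ≤ 21 * (s + 1) ^ 2 * M * lM := by gcongr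
    obtain ⟨k, hk⟩ := Nat.exists_eq_add_of_le h2
    rw [hk]
    refine (hc.mono h1).pad ?_ k
    have : 1 ≤ (s + 1) * d ^ (s + 1) * N := by
      have : 1 ≤ d ^ (s + 1) := Nat.one_le_pow _ _ hd
      exact Nat.mul_pos (Nat.mul_pos (by omega) this) hN
    simp only [Fintype.card_unit]
    calc 1 * 2 ≤ 38 * ((s + 1) * d ^ (s + 1) * N) := by omega
      _ = 38 * (s + 1) * d ^ (s + 1) * N := by ring
      _ ≤ W := h1
  · have spec := fun i => cellIndex_spec (by omega) hδ0 hδ1 (hS0 x hx i) (hS1 x hx i) (hS x hx i)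
    have hy : ∀ i, cellCenter K δ x i ∈ Set.Icc (0 : ℝ) 1 := by
      intro i
      rw [cellCenter]
      refine ⟨by positivity, ?_⟩
      rw [div_le_one hK0]
      have := (spec i).2.1
      exact_mod_cast (by omega : 2 * cellIndex K δ (x i) + 1 ≤ K)
    have h1 := hfT x (cellCenter K δ x) hx.1 hy (1 / K) (by positivity)
      (fun i => (spec i).2.2.2)
    have h2 := hc' x hx
    rw [abs_sub_comm] at h2
    refine (abs_sub_le _ _ _).trans ((add_le_add h1 h2).trans ?_)
    exact remainder_le hd hr0 hr1 hβ hB₀ hNM'.le (by rwa [mul_comm])
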